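/- **Theorem.** For $n\ge 1$ let $(t_e)$, with $e$ ranging over the $\binom n2$ edges of the complete graph on $[n]=\{1,\dots,n\}$, be independent random variables uniformly distributed on $[0,1]$. For $t\ge 0$ let $G(t)$ be the graph on $[n]$ with edge set $\{e : t_e\le t\}$ (the Erdős–Rényi graph process; it is complete for $t\ge 1$), and let $\mathcal C(t)=\mathrm{Cl}(G(t))$ be its clique complex, i.e. the simplicial complex whose simplices are the nonempty cliques of $G(t)$. Fix a field $K$ of characteristic zero. The family $\{\mathcal C(t)\}_{t\ge 0}$ is a filtration; for $k\ge 0$ its $k$-th persistent homology is the family of simplicial homology spaces $H_k(\mathcal C(t);K)$ (reduced homology if $k=0$), $t\ge 0$, with the maps induced by the inclusions $\mathcal C(s)\subset\mathcal C(t)$, $s\le t$. It decomposes as a finite direct sum of interval modules supported on intervals $[b_i,d_i)$ with $0\le b_i<d_i\le\infty$, and the pairs $(b_i,d_i)$ are unique up to order. Let $$L_k=\sum_i (d_i-b_i)\in[0,\infty]$$ be the lifetime sum. Then $L_k$ is a random variable and the following hold. 1. For $d\in\{1,2\}$ there are constants $c,C>0$ such that for all sufficiently large $n$ $$c\,n^{d-1}\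 \le\ \mathbb E[L_{d-1}]\ \le\ C\,n^{d-1}\log n .$$ 2. For every integer $d\ge 3$ there are constants $c,C>0$, depending only on $d$, such that for all sufficiently large $n$ $$c\,n^{\frac{(d+2)(d-1)}{2d}}\ \le\ \mathbb E[L_{d-1}]\ \le\ C\,n^{d-1}.$$ -/

import Mathlib

open MeasureTheory ProbabilityTheory
open scoped NNReal ENNReal

set_option maxSynthPendingDepth 3

universe u v

noncomputable section

namespace SimplicialPersistence

/-! ### Simplicial homology over a field (reduced in degree `0`) -/

section Homology

variable (K : Type*) [Field K] {V : Type*} [LinearOrder V]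

/-- The augmented simplicial boundary map on formal combinations of finite subsets of an ordered
vertex set: `∂⟨v₀ ⋯ v_k⟩ = ∑ⱼ (-1)^j ⟨v₀ ⋯ v̂ⱼ ⋯ v_k⟩` for `v₀ < ⋯ < v_k`. The index `j` of a vertex
`v` of `σ` is the number of vertices of `σ` below `v`. The boundary of a vertex is the generator of
the empty set (this is the augmentation), and the boundary of the empty set is `0`. -/
def boundary : (Finset V →₀ K) →ₗ[K] (Finset V →₀ K) :=
  Finsupp.linearCombination K fun σ : Finset V =>
    ∑ v ∈ σ, Finsupp.single (σ.erase v) ((-1 : K) ^ (σ.filter fun w => w < v).card)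

/-- The `k`-chains `C_k(X)`: formal combinations of the `k`-simplices of `X`. -/
def chains (X : AbstractSimplicialComplex V) (k : ℕ) : Submodule K (Finset V →₀ K) :=
  Finsupp.supported K K {σ | σ ∈ X ∧ σ.card = k + 1}

/-- The `k`-cycles `Z_k(X)` (for `k = 0`: the reduced ones, of coefficient sum `0`). -/
def cycles (X : AbstractSimplicialComplex V) (k : ℕ) : Submodule K (Finset V →₀ K) :=
  chains K X k ⊓ LinearMap.ker (boundary K)

/-- The `k`-boundaries `B_k(X)`. -/
def boundaries (X : AbstractSimplicialComplex V) (k : ℕ) : Submodule K (Finset V →₀ K) :=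
  (chains K X (k + 1)).map (boundary K)

set_option linter.unusedSectionVars false in
variable {K} in
theorem chains_mono {X Y : AbstractSimplicialComplex V} (h : X ≤ Y) (k : ℕ) :
    chains K X k ≤ chains K Y k :=
  Finsupp.supported_mono fun _ hσ => ⟨h hσ.1, hσ.2⟩

variable {K} in
theorem cycles_mono {X Y : AbstractSimplicialComplex V} (h : X ≤ Y) (k : ℕ) :
    cycles K X k ≤ cycles K Y k :=
  inf_le_inf_right _ (chains_mono h k)

variable {K} in
theorem boundaries_mono {X Y : AbstractSimplicialComplex V} (h : X ≤ Y) (k : ℕ) :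
    boundaries K X k ≤ boundaries K Y k :=
  Submodule.map_mono (chains_mono h (k + 1))

/-- The simplicial homology `H_k(X) = Z_k(X) / B_k(X)` with coefficients in `K`, reduced for
`k = 0`. -/
abbrev Homology (X : AbstractSimplicialComplex V) (k : ℕ) : Type _ :=
  cycles K X k ⧸ (boundaries K X k).submoduleOf (cycles K X k)

/-- The map `H_k(X) → H_k(Y)` induced by the inclusion of a subcomplex `X` of `Y`. -/
def homologyMap {X Y : AbstractSimplicialComplex V} (h : X ≤ Y) (k : ℕ) :
    Homology K X k →ₗ[K] Homology K Y k :=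
  Submodule.mapQ _ _ (Submodule.inclusion (cycles_mono h k))
    fun _ hz => boundaries_mono h k hz

end Homology

/-! ### Persistence diagrams and lifetime sums -/

/-- A finite list of birth-death pairs `(bᵢ, dᵢ)` with `0 ≤ bᵢ < dᵢ ≤ ∞`. -/
structure Barcode where
  size : ℕ
  birth : Fin size → ℝ≥0
  death : Fin size → ℝ≥0∞
  birth_lt_death : ∀ i, (birth i : ℝ≥0∞) < death i

namespace Barcode

/-- The indices of the bars `[bᵢ, dᵢ)` that contain `t`. -/
def Alive (B : Barcode) (t : ℝ≥0) : Type :=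
  {i : Fin B.size // B.birth i ≤ t ∧ (t : ℝ≥0∞) < B.death i}

/-- The sum of the lifetimes `dᵢ - bᵢ`; it is `∞` if some `dᵢ` is. -/
def lifetimeSum (B : Barcode) : ℝ≥0∞ :=
  ∑ i, (B.death i - B.birth i)

end Barcode

section Persistence

variable (K : Type*) [Field K] {V : Type*} [LinearOrder V]

/-- `B` is the list of points of the `k`-th persistence diagram of the filtration `X`: the
persistent homology `(H_k(X(t)))_t`, with the maps induced by the inclusions, is isomorphic to the
direct sum of the interval modules `⨁ᵢ (z^{bᵢ}) / (z^{dᵢ})` (with `⨁ᵢ (z^{bᵢ})` for `dᵢ = ∞`).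
The degree-`t` part of the direct sum is `K^{i : bᵢ ≤ t < dᵢ}`, and multiplication by `z^{t - s}`
is the identity on each summand that is present at both `s` and `t`, and zero on the others. -/
def IsPersistenceDiagram (X : ℝ≥0 →o AbstractSimplicialComplex V) (k : ℕ) (B : Barcode) : Prop :=
  ∃ φ : ∀ t : ℝ≥0, Homology K (X t) k ≃ₗ[K] (B.Alive t → K),
    ∀ (s t : ℝ≥0) (h : s ≤ t) (x : Homology K (X s) k) (i : B.Alive t),
      φ t (homologyMap K (X.monotone h) k x) i =
        if hs : B.birth i.1 ≤ s then
          φ s x ⟨i.1, hs, (ENNReal.coe_le_coe.2 h).trans_lt i.2.2⟩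
        else 0

open Classical in
/-- The lifetime sum `L_k = ∑ᵢ (dᵢ - bᵢ)` of the `k`-th persistent homology of a filtration, over
the points of its persistence diagram. The value is `∞` for a filtration that has no finite
persistence diagram. -/
def lifetimeSum (X : ℝ≥0 →o AbstractSimplicialComplex V) (k : ℕ) : ℝ≥0∞ :=
  if h : ∃ B : Barcode, IsPersistenceDiagram K X k B then h.choose.lifetimeSum else ∞

end Persistence

/-! ### The clique complex process -/

/-- The clique complex `Cl(G)`: its simplices are the nonempty finite cliques of `G`. -/
def cliqueComplex {V : Type*} (G : SimpleGraph V) : AbstractSimplicialComplex V where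
  faces := {σ | σ.Nonempty ∧ G.IsClique (σ : Set V)}
  isRelLowerSet_faces := fun _ hσ =>
    ⟨hσ.1, fun _ hτσ hτ => ⟨hτ, hσ.2.subset (Finset.coe_subset.2 hτσ)⟩⟩
  singleton_mem v := ⟨Finset.singleton_nonempty v, by simp⟩

theorem cliqueComplex_mono {V : Type*} : Monotone (cliqueComplex (V := V)) :=
  fun _ _ h _ hσ => ⟨hσ.1, hσ.2.mono h⟩

/-- The edges of the complete graph on `n` vertices. -/
abbrev Edge (n : ℕ) : Type := (⊤ : SimpleGraph (Fin n)).edgeSet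

/-- The graph on `n` vertices at time `t`: the edges `e` with birth time `τ e ≤ t`. -/
def graphAt {n : ℕ} (τ : Edge n → ℝ) (t : ℝ≥0) : SimpleGraph (Fin n) :=
  SimpleGraph.fromEdgeSet {e | ∃ h : e ∈ (⊤ : SimpleGraph (Fin n)).edgeSet, τ ⟨e, h⟩ ≤ t}

/-- The filtration of clique complexes `t ↦ Cl(G(t))` for given birth times of the edges. For birth
times in `[0, 1]` it is constant from `t = 1` on. -/
def cliqueFiltration {n : ℕ} (τ : Edge n → ℝ) : ℝ≥0 →o AbstractSimplicialComplex (Fin n) where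
  toFun t := cliqueComplex (graphAt τ t)
  monotone' _ _ hst := cliqueComplex_mono <| SimpleGraph.fromEdgeSet_mono fun _ he =>
    ⟨he.1, he.2.trans (NNReal.coe_le_coe.2 hst)⟩

/-- The birth times of the edges in the Erdős–Rényi graph process on `n` vertices: independent
random variables, uniformly distributed on `[0, 1]`. -/
structure IsErdosRenyiProcess {Ω : Type*} [MeasurableSpace Ω] (P : Measure Ω) {n : ℕ}
    (τ : Edge n → Ω → ℝ) : Prop where
  measurable : ∀ e, Measurable (τ e)
  indep : iIndepFun τ P
  uniform : ∀ e, pdf.IsUniform (τ e) (Set.Icc 0 1) P volume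

/-- The random variable `L_k`: the lifetime sum of the `k`-th persistent homology, with coefficients
in `K`, of the clique complex process with random edge birth times `τ`. -/
def cliqueLifetimeSum (K : Type*) [Field K] {Ω : Type*} {n : ℕ} (τ : Edge n → Ω → ℝ) (k : ℕ)
    (ω : Ω) : ℝ≥0∞ :=
  lifetimeSum K (cliqueFiltration fun e => τ e ω) k

end SimplicialPersistence

end

namespace SimplicialPersistence

/-! ### Bases adapted to two chains of subspaces -/

section AdaptedBasis

variable {K : Type*} [Field K] {ι : Type*}

/-- A chain of subspaces of a nonzero finite-dimensional space has all its proper members inside a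
common hyperplane. -/
theorem exists_isCoatom_forall_le {W : Type*} [AddCommGroup W] [Module K W]
    [FiniteDimensional K W] [Nontrivial W] (A : ι → Submodule K W)
    (hA : ∀ i j, A i ≤ A j ∨ A j ≤ A i) :
    ∃ H : Submodule K W, IsCoatom H ∧ ∀ i, A i ≠ ⊤ → A i ≤ H := by
  -- Inserting `⊥` provides a maximal element even if no `A i` is proper; in a chain, maximal means
  -- greatest.
  obtain ⟨M, hM, hmax⟩ := (wellFounded_gt (α := Submodule K W)).has_min
    (insert ⊥ {S | S ≠ ⊤ ∧ ∃ i, A i = S}) (Set.insert_nonempty _ _)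
  have hMtop : M ≠ ⊤ := by
    rcases hM with rfl | hM
    · exact bot_ne_top
    · exact hM.1
  obtain ⟨H, hH, hMH⟩ := (eq_top_or_exists_le_coatom M).resolve_left hMtop
  refine ⟨H, hH, fun i hi => le_trans ?_ hMH⟩
  have h1 : ¬ M < A i := hmax (A i) (Set.mem_insert_of_mem _ ⟨hi, i, rfl⟩)
  rcases hM with rfl | ⟨-, j, rfl⟩
  · by_contra h
    exact h1 (bot_lt_iff_ne_bot.2 fun h' => h h'.le)
  · rcases hA i j with h | h
    · exact h
    · exact (eq_of_le_of_not_lt h h1).ge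

/-- For a chain of subspaces and a proper subspace `H` there is a vector outside `H` that lies in
all members of the chain that are not contained in `H`. -/
theorem exists_notMem_forall_mem {W : Type*} [AddCommGroup W] [Module K W]
    [FiniteDimensional K W] (B : ι → Submodule K W) (hB : ∀ i j, B i ≤ B j ∨ B j ≤ B i)
    {H : Submodule K W} (hH : H ≠ ⊤) : ∃ e, e ∉ H ∧ ∀ i, ¬ B i ≤ H → e ∈ B i := by
  obtain ⟨M, hM, hmin⟩ := (wellFounded_lt (α := Submodule K W)).has_min
    (insert ⊤ {S | ¬ S ≤ H ∧ ∃ i, B i = S}) (Set.insert_nonempty _ _)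
  have hMH : ¬ M ≤ H := by
    rcases hM with rfl | hM
    · exact fun h => hH (top_le_iff.1 h)
    · exact hM.1
  obtain ⟨e, heM, heH⟩ := SetLike.not_le_iff_exists.1 hMH
  refine ⟨e, heH, fun i hi => ?_⟩
  have h1 : ¬ B i < M := hmin (B i) (Set.mem_insert_of_mem _ ⟨hi, i, rfl⟩)
  rcases hM with rfl | ⟨-, j, rfl⟩
  · have : B i = ⊤ := by
      by_contra h
      exact h1 (lt_top_iff_ne_top.2 h)
    simp [this]
  · rcases hB i j with h | h
    · exact (eq_of_le_of_not_lt h h1).ge heM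
    · exact h heM

/-- Two chains of subspaces of a finite-dimensional space have a common adapted basis. -/
theorem exists_basis_adapted (n : ℕ) : ∀ (W : Type*) [AddCommGroup W] [Module K W]
    [FiniteDimensional K W], Module.finrank K W = n → ∀ A B : ι → Submodule K W,
    (∀ i j, A i ≤ A j ∨ A j ≤ A i) → (∀ i j, B i ≤ B j ∨ B j ≤ B i) →
    ∃ b : Module.Basis (Fin n) K W, (∀ i, A i ≤ Submodule.span K (b '' {j | b j ∈ A i})) ∧
      ∀ i, B i ≤ Submodule.span K (b '' {j | b j ∈ B i}) := by
  induction n with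
  | zero =>
    intro W _ _ _ hW A B _ _
    have : Subsingleton W := Module.finrank_zero_iff.1 hW
    have h (S T : Submodule K W) : S ≤ T := fun x _ => by
      rw [Subsingleton.elim x 0]; exact T.zero_mem
    exact ⟨Module.finBasisOfFinrankEq K W hW, fun _ => h _ _, fun _ => h _ _⟩
  | succ n ih =>
    intro W _ _ _ hW A B hA hB
    have : Nontrivial W := Module.nontrivial_of_finrank_eq_succ hW
    -- Each `A i` is `⊤` or inside `H`, and each `B i` is inside `H` or contains `e`. So adjoining
    -- `e` to a basis of `H` adapted to the traces of both chains works.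
    obtain ⟨H, hH, hAH⟩ := exists_isCoatom_forall_le A hA
    obtain ⟨e, heH, heB⟩ := exists_notMem_forall_mem B hB hH.1
    have hli : ∀ c : K, ∀ x ∈ H, c • e + x = 0 → c = 0 := by
      intro c x hx h
      by_contra hc
      refine heH ((H.smul_mem_iff hc).1 ?_)
      rw [eq_neg_of_add_eq_zero_left h]
      exact H.neg_mem hx
    have hsp : ∀ z : W, ∃ c : K, z + c • e ∈ H := by
      intro z
      have htop : H ⊔ K ∙ e = ⊤ := hH.2 _ <| lt_of_le_of_ne le_sup_left fun h =>
        heH (h ▸ le_sup_right (a := H) (Submodule.mem_span_singleton_self e))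
      obtain ⟨y, hy, w, hw, rfl⟩ := Submodule.mem_sup.1 (htop ▸ Submodule.mem_top : z ∈ H ⊔ K ∙ e)
      obtain ⟨c, rfl⟩ := Submodule.mem_span_singleton.1 hw
      exact ⟨-c, by simpa using hy⟩
    have hn : Module.finrank K H = n := by
      have := Module.finrank_eq_card_basis
        (Module.Basis.mkFinCons e (Module.finBasis K H) hli hsp)
      simp only [Fintype.card_fin] at this
      omega
    obtain ⟨b, hbA, hbB⟩ := ih H hn (fun i => (A i).comap H.subtype)
      (fun i => (B i).comap H.subtype)
      (fun i j => (hA i j).imp (fun h => Submodule.comap_mono h) fun h => Submodule.comap_mono h)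
      (fun i j => (hB i j).imp (fun h => Submodule.comap_mono h) fun h => Submodule.comap_mono h)
    set b' := Module.Basis.mkFinCons e b hli hsp with hb'
    have hb'0 : b' 0 = e := by rw [hb', Module.Basis.coe_mkFinCons]; rfl
    have hb's (j : Fin n) : b' j.succ = b j := by rw [hb', Module.Basis.coe_mkFinCons]; rfl
    have key (S : Submodule K W)
        (h : S.comap H.subtype ≤ Submodule.span K (b '' {j | b j ∈ S.comap H.subtype}))
        {x : W} (hxS : x ∈ S) (hxH : x ∈ H) : x ∈ Submodule.span K (b' '' {j | b' j ∈ S}) := by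
      have h1 : (⟨x, hxH⟩ : H) ∈ Submodule.span K (b '' {j | b j ∈ S.comap H.subtype}) := h hxS
      have h2 := Submodule.mem_map_of_mem (f := H.subtype) h1
      rw [Submodule.map_span] at h2
      refine Submodule.span_mono ?_ h2
      rintro _ ⟨_, ⟨j, hj, rfl⟩, rfl⟩
      exact ⟨j.succ, by simpa [hb's] using hj, hb's j⟩
    refine ⟨b', fun i => ?_, fun i => ?_⟩
    · by_cases hi : A i = ⊤
      · simp [hi, b'.span_eq]
      · exact fun x hx => key _ (hbA i) hx (hAH i hi hx)
    · by_cases hi : B i ≤ H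
      · exact fun x hx => key _ (hbB i) hx (hi hx)
      · intro x hx
        -- As `e ∈ B i`, the vector `x` can be moved into `H` along `e` without leaving `B i`.
        obtain ⟨c, hc⟩ := hsp x
        have he := heB i hi
        have h1 := key _ (hbB i) ((B i).add_mem hx ((B i).smul_mem c he)) hc
        have h2 : e ∈ Submodule.span K (b' '' {j | b' j ∈ B i}) :=
          Submodule.subset_span ⟨0, by simpa [hb'0] using he, hb'0⟩
        simpa using Submodule.sub_mem _ h1 (Submodule.smul_mem _ c h2)

end AdaptedBasis

/-! ### Existence of persistence diagrams and the integral formula for lifetime sums -/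

/-- An upward closed set of times that is locally closed on the left is a ray `[d, ∞)` or empty. -/
theorem exists_forall_mem_iff_le {S : Set ℝ≥0} (hS : IsUpperSet S)
    (hr : ∀ t, (∃ s > t, ∀ r, t < r → r < s → r ∈ S) → t ∈ S) :
    ∃ d : ℝ≥0∞, ∀ t : ℝ≥0, t ∈ S ↔ d ≤ t := by
  rcases S.eq_empty_or_nonempty with rfl | hne
  · exact ⟨∞, by simp⟩
  · refine ⟨(sInf S : ℝ≥0), fun t => ?_⟩
    rw [ENNReal.coe_le_coe]
    refine ⟨fun h => csInf_le (OrderBot.bddBelow S) h, fun h => ?_⟩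
    refine hS h (hr _ ⟨sInf S + 1, by simp, fun r hr _ => ?_⟩)
    obtain ⟨q, hq, hqr⟩ := exists_lt_of_csInf_lt hne hr
    exact hS hqr.le hq

section Diagram

variable {K : Type*} [Field K] {V : Type*}

/-- A filtration is right-continuous if it is constant on a right neighbourhood of every time. -/
def RightContinuous (X : ℝ≥0 →o AbstractSimplicialComplex V) : Prop :=
  ∀ t, ∃ s > t, ∀ r, t < r → r < s → X r = X t

/-- Gives the entry time of a vector into the cycles or the boundaries, `∞` if it never enters.
Right-continuity makes the entry time attained, which is why bars are half-open `[b, d)`. -/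
theorem RightContinuous.exists_forall_mem_iff_le {X : ℝ≥0 →o AbstractSimplicialComplex V}
    (hX : RightContinuous X) {W : Type*} [AddCommGroup W] [Module K W]
    (F : AbstractSimplicialComplex V → Submodule K W) (hF : Monotone F) (x : W) :
    ∃ d : ℝ≥0∞, ∀ t : ℝ≥0, x ∈ F (X t) ↔ d ≤ t := by
  refine SimplicialPersistence.exists_forall_mem_iff_le (S := {t | x ∈ F (X t)})
    (fun s t hst hs => hF (X.monotone hst) hs) ?_
  rintro t ⟨s, hts, h⟩
  obtain ⟨s', hts', h'⟩ := hX t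
  obtain ⟨r, hr, hr'⟩ := exists_between (lt_min hts hts')
  have := h r hr (hr'.trans_le (min_le_left _ _))
  rwa [Set.mem_ofPred_eq, h' r hr (hr'.trans_le (min_le_right _ _))] at this

variable [LinearOrder V]

/-- In an adapted basis, `b j` is a cycle from time `β j` on and a boundary from `δ j` on. The
classes of the `b j` with `β j ≤ t < δ j` form a basis of the homology at `t`, and inclusions send
each such class to itself or to zero. -/
theorem exists_isPersistenceDiagram [Finite V] (X : ℝ≥0 →o AbstractSimplicialComplex V)
    (hX : RightContinuous X) (k : ℕ) : ∃ B : Barcode, IsPersistenceDiagram K X k B := by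
  classical
  obtain ⟨b, hbZ, hbB⟩ := exists_basis_adapted (K := K) _ (Finset V →₀ K) rfl
    (fun t => cycles K (X t) k) (fun t => boundaries K (X t) k)
    (fun s t => (le_total s t).imp (fun h => cycles_mono (X.monotone h) k)
      fun h => cycles_mono (X.monotone h) k)
    (fun s t => (le_total s t).imp (fun h => boundaries_mono (X.monotone h) k)
      fun h => boundaries_mono (X.monotone h) k)
  choose β hβ using fun j => hX.exists_forall_mem_iff_le (fun Y => cycles K Y k)
    (fun _ _ h => cycles_mono h k) (b j)
  choose δ hδ using fun j => hX.exists_forall_mem_iff_le (fun Y => boundaries K Y k)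
    (fun _ _ h => boundaries_mono h k) (b j)
  have reprZ {t : ℝ≥0} {z} (hz : z ∈ cycles K (X t) k) {j} (hj : b.repr z j ≠ 0) :
      β j ≤ t := (hβ j t).1 (b.mem_span_image.1 (hbZ t hz) (by simpa using hj))
  have reprB {t : ℝ≥0} {z} (hz : z ∈ boundaries K (X t) k) {j} (hj : b.repr z j ≠ 0) :
      δ j ≤ t := (hδ j t).1 (b.mem_span_image.1 (hbB t hz) (by simpa using hj))
  -- Other basis vectors contribute nothing: they never become cycles or are boundaries once they
  -- are cycles. For `j ∈ J` the birth `β j` is finite.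
  let J := {j // β j < δ j}
  let e := (Fintype.equivFin J).symm
  let B : Barcode :=
    { size := Fintype.card J
      birth := fun i => (β (e i).1).toNNReal
      death := fun i => δ (e i).1
      birth_lt_death := fun i => by
        rw [ENNReal.coe_toNNReal (e i).2.ne_top]; exact (e i).2 }
  have hbirth (i : Fin B.size) (t : ℝ≥0) : B.birth i ≤ t ↔ β (e i).1 ≤ t := by
    rw [← ENNReal.coe_le_coe, ENNReal.coe_toNNReal (e i).2.ne_top]
  -- The coordinates along the bars alive at `t`. This map is onto with kernel the boundaries, so it
  -- induces the required isomorphism.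
  let f (t : ℝ≥0) : cycles K (X t) k →ₗ[K] (B.Alive t → K) :=
    LinearMap.pi fun i => b.coord (e i.1).1 ∘ₗ (cycles K (X t) k).subtype
  have hf (t : ℝ≥0) (z) (i : B.Alive t) : f t z i = b.repr z.1 (e i.1).1 := rfl
  have hker (t : ℝ≥0) :
      (boundaries K (X t) k).submoduleOf (cycles K (X t) k) = LinearMap.ker (f t) := by
    ext z
    rw [LinearMap.mem_ker]
    change z.1 ∈ boundaries K (X t) k ↔ _
    constructor
    · intro hz
      ext i
      by_contra h
      exact (i.2.2.trans_le (reprB hz h)).false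
    · intro hz
      rw [← b.linearCombination_repr z.1, Finsupp.linearCombination_apply, Finsupp.sum]
      refine Submodule.sum_mem _ fun j hj => Submodule.smul_mem _ _ ?_
      have hj0 : b.repr z.1 j ≠ 0 := by simpa using hj
      rw [hδ]
      by_contra hd
      rw [not_le] at hd
      have hb := reprZ z.2 hj0
      let j' : J := ⟨j, hb.trans_lt hd⟩
      have hi : e (e.symm j') = j' := e.apply_symm_apply j'
      refine hj0 ?_
      have : b.repr z.1 (e (e.symm j')).1 = 0 := congrFun hz ⟨e.symm j', by rw [hbirth, hi]; exact hb,
        by change _ < δ _; rw [hi]; exact hd⟩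
      rwa [hi] at this
  have hsurj (t : ℝ≥0) : Function.Surjective (f t) := by
    intro g
    have : Fintype (B.Alive t) := by unfold Barcode.Alive; infer_instance
    refine ⟨⟨∑ i, g i • b (e i.1).1, Submodule.sum_mem _ fun i _ => Submodule.smul_mem _ _ ?_⟩, ?_⟩
    · rw [hβ]
      exact (hbirth _ _).1 i.2.1
    · ext i
      rw [hf]
      simp only [map_sum, map_smul, Module.Basis.repr_self, Finsupp.coe_finsetSum,
        Finset.sum_apply, Finsupp.smul_single, smul_eq_mul, mul_one]
      rw [Finset.sum_eq_single i]
      · simp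
      · intro i' _ hi'
        refine Finsupp.single_eq_of_ne fun h => hi' ?_
        exact Subtype.ext (e.injective (Subtype.ext h.symm))
      · simp
  refine ⟨B, fun t => (Submodule.quotEquivOfEq _ _ (hker t)).trans
    ((f t).quotKerEquivOfSurjective (hsurj t)), ?_⟩
  intro s t h x i
  obtain ⟨z, rfl⟩ := Submodule.Quotient.mk_surjective _ x
  -- The isomorphisms at `s` and `t` read the same coordinate of the same chain `z`; it vanishes if
  -- the bar is born after `s`.
  change b.repr z.1 (e i.1).1 = if hs : B.birth i.1 ≤ s then b.repr z.1 (e i.1).1 else 0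
  split_ifs with hs
  · rfl
  · by_contra h0
    exact hs ((hbirth _ _).2 (reprZ z.2 h0))

/-- Every diagram has the Betti numbers as its counts of living bars, so the arbitrary choice in
`lifetimeSum` is harmless. -/
theorem IsPersistenceDiagram.finrank_eq {X : ℝ≥0 →o AbstractSimplicialComplex V} {k : ℕ}
    {B : Barcode} (hB : IsPersistenceDiagram K X k B) (t : ℝ≥0) :
    Module.finrank K (Homology K (X t) k) = Nat.card (B.Alive t) := by
  classical
  obtain ⟨φ, -⟩ := hB
  have : Fintype (B.Alive t) := by unfold Barcode.Alive; infer_instance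
  rw [(φ t).finrank_eq, Module.finrank_fintype_fun_eq_card, Nat.card_eq_fintype_card]

theorem Barcode.lifetimeSum_eq_lintegral (B : Barcode) :
    B.lifetimeSum = ∫⁻ t in Set.Ici (0 : ℝ), (Nat.card (B.Alive t.toNNReal) : ℝ≥0∞) := by
  classical
  -- Negative times are sent to `0` by `toNNReal`; intersecting with `Set.Ici 0` leaves exactly the
  -- bar, whose length is its lifetime.
  let S (i : Fin B.size) : Set ℝ :=
    {t | B.birth i ≤ t.toNNReal ∧ (t.toNNReal : ℝ≥0∞) < B.death i}
  have hS (i) : MeasurableSet (S i) :=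
    (measurableSet_le measurable_const measurable_real_toNNReal).inter
      (measurableSet_lt measurable_real_toNNReal.coe_nnreal_ennreal measurable_const)
  have hcard (t : ℝ) : (Nat.card (B.Alive t.toNNReal) : ℝ≥0∞) =
      ∑ i, (S i).indicator (fun _ => 1) t := by
    have h : Nat.card (B.Alive t.toNNReal) = (Finset.univ.filter fun i =>
        B.birth i ≤ t.toNNReal ∧ (t.toNNReal : ℝ≥0∞) < B.death i).card :=
      Nat.subtype_card _ fun i => by simp
    rw [h, Finset.card_eq_sum_ones, Finset.sum_filter]
    push_cast
    refine Finset.sum_congr rfl fun i _ => ?_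
    simp [Set.indicator, S]
  simp_rw [hcard]
  rw [lintegral_finsetSum _ fun i _ => measurable_const.indicator (hS i), Barcode.lifetimeSum]
  refine Finset.sum_congr rfl fun i _ => ?_
  rw [lintegral_indicator_const (hS i), one_mul, Measure.restrict_apply (hS i)]
  cases hd : B.death i with
  | top =>
    have : S i ∩ Set.Ici 0 = Set.Ici (B.birth i : ℝ) := by
      ext t
      simp only [S, hd, Set.mem_inter_iff, Set.mem_ofPred_eq, Set.mem_Ici, ENNReal.coe_lt_top,
        and_true]
      constructor
      · rintro ⟨h1, h2⟩
        simpa [h2] using NNReal.coe_le_coe.2 h1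
      · intro h
        exact ⟨NNReal.le_toNNReal_of_coe_le h, le_trans (by positivity) h⟩
    simp [this]
  | coe d =>
    have : S i ∩ Set.Ici 0 = Set.Ico (B.birth i : ℝ) d := by
      ext t
      simp only [S, hd, Set.mem_inter_iff, Set.mem_ofPred_eq, Set.mem_Ici, ENNReal.coe_lt_coe,
        Set.mem_Ico]
      constructor
      · rintro ⟨⟨h1, h3⟩, h2⟩
        have := NNReal.coe_le_coe.2 h1
        have := NNReal.coe_lt_coe.2 h3
        simp_all
      · rintro ⟨h, h'⟩
        have h0 : 0 ≤ t := le_trans (by positivity) h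
        exact ⟨⟨NNReal.le_toNNReal_of_coe_le h, (Real.toNNReal_lt_iff_lt_coe h0).2 h'⟩, h0⟩
    rw [this, Real.volume_Ico, ENNReal.ofReal_sub _ (by positivity), ENNReal.ofReal_coe_nnreal,
      ENNReal.ofReal_coe_nnreal]

/-- The lifetime sum is the integral of the Betti number over time. -/
theorem lifetimeSum_eq_lintegral [Finite V] (X : ℝ≥0 →o AbstractSimplicialComplex V)
    (hX : RightContinuous X) (k : ℕ) :
    lifetimeSum K X k = ∫⁻ t in Set.Ici (0 : ℝ),
      (Module.finrank K (Homology K (X t.toNNReal) k) : ℝ≥0∞) := by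
  have h := exists_isPersistenceDiagram (K := K) X hX k
  rw [lifetimeSum, dif_pos h, Barcode.lifetimeSum_eq_lintegral]
  simp_rw [h.choose_spec.finrank_eq]

end Diagram

/-! ### Bounds for the Betti numbers of a clique complex -/

section Betti

variable {K : Type*} [Field K] {V : Type*}

/-- The cliques with `k` vertices of a graph. -/
def cliques (G : SimpleGraph V) (k : ℕ) : Set (Finset V) :=
  {σ | G.IsClique (σ : Set V) ∧ σ.card = k}

theorem chains_cliqueComplex (G : SimpleGraph V) (k : ℕ) :
    chains K (cliqueComplex G) k =
      Finsupp.supported K K (cliques G (k + 1)) := by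
  unfold chains
  congr 1
  ext σ
  constructor
  · rintro ⟨h, h'⟩
    exact ⟨h.2, h'⟩
  · rintro ⟨h, h'⟩
    exact ⟨⟨Finset.card_pos.1 (by omega), h⟩, h'⟩

theorem finrank_supported {α : Type*} [Finite α] (S : Set α) :
    Module.finrank K (Finsupp.supported K K S) = S.ncard := by
  have := Fintype.ofFinite S
  rw [(Finsupp.supportedEquivFinsupp S).finrank_eq, Module.finrank_finsupp_self,
    ← Nat.card_coe_set_eq, Nat.card_eq_fintype_card]

theorem supported_le_iff {α : Type*} {S : Set α} {T : Submodule K (α →₀ K)} :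
    Finsupp.supported K K S ≤ T ↔ ∀ a ∈ S, Finsupp.single a 1 ∈ T := by
  rw [Finsupp.supported_eq_span_single, Submodule.span_le, Set.image_subset_iff]
  rfl

variable [LinearOrder V]

theorem boundary_single (σ : Finset V) :
    boundary K (Finsupp.single σ 1) =
      ∑ v ∈ σ, Finsupp.single (σ.erase v) ((-1 : K) ^ (σ.filter fun w => w < v).card) := by
  simp [boundary]

/-- For `k = 0` the target is the line spanned by the empty set, which belongs to `cliques G 0`;
this is the augmentation. -/
theorem map_boundary_chains_le (G : SimpleGraph V) (k : ℕ) :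
    (chains K (cliqueComplex G) k).map (boundary K) ≤
      Finsupp.supported K K (cliques G k) := by
  rw [Submodule.map_le_iff_le_comap, chains_cliqueComplex, supported_le_iff]
  rintro σ ⟨hσ, hc⟩
  rw [Submodule.mem_comap, boundary_single]
  refine Submodule.sum_mem _ fun v hv => Finsupp.single_mem_supported _ _ ⟨?_, ?_⟩
  · exact hσ.subset (Finset.coe_subset.2 (Finset.erase_subset _ _))
  · rw [Finset.card_erase_of_mem hv, hc, Nat.add_sub_cancel]

/-- The Morse-type lower bound for Betti numbers. -/
theorem ncard_cliques_le [Finite V] (G : SimpleGraph V) (k : ℕ) :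
    (cliques G (k + 1)).ncard ≤
      Module.finrank K (Homology K (cliqueComplex G) k) +
        (cliques G k).ncard + (cliques G (k + 2)).ncard := by
  set C := chains K (cliqueComplex G) k with hC
  set Z := cycles K (cliqueComplex G) k with hZ
  set B := boundaries K (cliqueComplex G) k with hB
  have h1 : Module.finrank K C = (cliques G (k + 1)).ncard := by
    rw [hC, chains_cliqueComplex, finrank_supported]
  have h2 := LinearMap.finrank_range_add_finrank_ker ((boundary K).domRestrict C)
  have h3 : Module.finrank K (LinearMap.range ((boundary K).domRestrict C)) ≤
      (cliques G k).ncard := by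
    rw [← finrank_supported (K := K), LinearMap.range_domRestrict]
    exact Submodule.finrank_mono (map_boundary_chains_le G k)
  have h4 : Module.finrank K (LinearMap.ker ((boundary K).domRestrict C)) =
      Module.finrank K Z := by
    have : LinearMap.ker ((boundary K).domRestrict C) = Z.comap C.subtype := by
      ext x
      simp [hZ, cycles, ← hC]
    rw [this]
    exact (Submodule.comapSubtypeEquivOfLe inf_le_left).finrank_eq
  have h5 := Submodule.finrank_quotient_add_finrank (B.submoduleOf Z)
  -- An inequality is enough here, so `∂² = 0` is not needed.
  have h6 : Module.finrank K (B.submoduleOf Z) ≤ Module.finrank K B := by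
    have : B.submoduleOf Z = (B ⊓ Z).comap Z.subtype := by
      ext x
      simp [Submodule.submoduleOf]
    rw [this, (Submodule.comapSubtypeEquivOfLe inf_le_right).finrank_eq]
    exact Submodule.finrank_mono inf_le_left
  have h7 : Module.finrank K B ≤
      (cliques G (k + 2)).ncard := by
    rw [← finrank_supported (K := K), ← chains_cliqueComplex G (k + 1)]
    exact Submodule.finrank_map_le _ _
  change _ ≤ Module.finrank K (Z ⧸ B.submoduleOf Z) + _ + _
  omega

/-- The cliques with `k` vertices that have no common neighbour below their least vertex. -/
def criticalCliques (G : SimpleGraph V) (k : ℕ) : Set (Finset V) :=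
  {σ | σ.card = k ∧ G.IsClique (σ : Set V) ∧ ∀ u, (∀ v ∈ σ, u < v) → ∃ v ∈ σ, ¬ G.Adj u v}

/-- Induction on the least vertex `m`. If `u` witnesses that `σ` is not critical, then `∂(insert u
σ)` is `σ` plus signed cliques with least vertex `u < m`, to which the induction hypothesis applies.
-/
theorem single_mem_supported_criticalCliques_sup_boundaries [Finite V] (G : SimpleGraph V) (k : ℕ)
    (m : V) : ∀ σ : Finset V, m ∈ σ → (∀ v ∈ σ, m ≤ v) → G.IsClique (σ : Set V) →
      σ.card = k + 1 → Finsupp.single σ (1 : K) ∈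
        Finsupp.supported K K (criticalCliques G (k + 1)) ⊔ boundaries K (cliqueComplex G) k := by
  induction m using WellFoundedLT.induction with
  | ind m ih =>
    intro σ hm hmin hσ hc
    by_cases hcrit : σ ∈ criticalCliques G (k + 1)
    · exact Submodule.mem_sup_left (Finsupp.single_mem_supported _ _ hcrit)
    · simp only [criticalCliques, Set.mem_ofPred_eq, not_and, not_forall, not_exists,
        not_not] at hcrit
      obtain ⟨u, hu, hadj⟩ := hcrit hc hσ
      have huσ : u ∉ σ := fun h => (hu u h).false
      have hτ : G.IsClique (insert u σ : Finset V) := by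
        rw [Finset.coe_insert]
        exact hσ.insert fun v hv _ => hadj v hv
      have hbd : boundary K (Finsupp.single (insert u σ) 1) ∈
          boundaries K (cliqueComplex G) k := by
        refine Submodule.mem_map_of_mem ?_
        rw [chains_cliqueComplex]
        exact Finsupp.single_mem_supported _ _ ⟨hτ, by rw [Finset.card_insert_of_notMem huσ, hc]⟩
      rw [boundary_single, Finset.sum_insert huσ, Finset.erase_insert huσ] at hbd
      have h0 : ((insert u σ).filter fun w => w < u) = ∅ := by
        refine Finset.filter_eq_empty_iff.2 fun w hw => not_lt.2 ?_
        rcases Finset.mem_insert.1 hw with rfl | hw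
        · exact le_rfl
        · exact (hu w hw).le
      rw [h0, Finset.card_empty, pow_zero] at hbd
      have hrest : ∑ v ∈ σ, Finsupp.single ((insert u σ).erase v)
          ((-1 : K) ^ ((insert u σ).filter fun w => w < v).card) ∈
          Finsupp.supported K K (criticalCliques G (k + 1)) ⊔
            boundaries K (cliqueComplex G) k := by
        refine Submodule.sum_mem _ fun v hv => ?_
        rw [← mul_one ((-1 : K) ^ _), ← smul_eq_mul, ← Finsupp.smul_single]
        refine Submodule.smul_mem _ _ (ih u (hu m hm) _ ?_ ?_ ?_ ?_)
        · exact Finset.mem_erase.2 ⟨(hu v hv).ne, Finset.mem_insert_self _ _⟩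
        · intro w hw
          rcases Finset.mem_insert.1 (Finset.mem_of_mem_erase hw) with rfl | hw
          · exact le_rfl
          · exact (hu w hw).le
        · exact hτ.subset (Finset.coe_subset.2 (Finset.erase_subset _ _))
        · rw [Finset.card_erase_of_mem (Finset.mem_insert_of_mem hv),
            Finset.card_insert_of_notMem huσ, hc, Nat.add_sub_cancel]
      simpa using Submodule.sub_mem _ (Submodule.mem_sup_right hbd) hrest

/-- The number of critical cliques bounds the Betti number. -/
theorem finrank_homology_le [Finite V] (G : SimpleGraph V) (k : ℕ) :
    Module.finrank K (Homology K (cliqueComplex G) k) ≤ (criticalCliques G (k + 1)).ncard := by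
  set Z := cycles K (cliqueComplex G) k with hZ
  set B := boundaries K (cliqueComplex G) k with hB
  have hC : Z ≤ Finsupp.supported K K (criticalCliques G (k + 1)) ⊔ B := by
    refine le_trans inf_le_left ?_
    rw [chains_cliqueComplex, supported_le_iff]
    rintro σ ⟨hσ, hc⟩
    have hne : σ.Nonempty := Finset.card_pos.1 (by omega)
    exact single_mem_supported_criticalCliques_sup_boundaries G k (σ.min' hne) σ
      (σ.min'_mem hne) (fun v hv => σ.min'_le v hv) hσ hc
  -- Homology is the image of `Z` in the quotient by `B`, where only the span of the critical
  -- cliques survives.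
  have hker : B.submoduleOf Z = LinearMap.ker (B.mkQ.domRestrict Z) := by
    ext x
    simp [Submodule.submoduleOf]
  rw [((Submodule.quotEquivOfEq _ _ hker).trans (LinearMap.quotKerEquivRange _)).finrank_eq,
    LinearMap.range_domRestrict, ← finrank_supported (K := K)]
  refine le_trans (Submodule.finrank_mono (Submodule.map_mono hC)) ?_
  rw [Submodule.map_sup]
  have : B.map B.mkQ = ⊥ := by simp
  rw [this, sup_bot_eq]
  exact Submodule.finrank_map_le _ _

/-- The cone operator with apex `a` on formal combinations of finite sets. -/
noncomputable def cone (K : Type*) [Field K] (a : V) : (Finset V →₀ K) →ₗ[K] (Finset V →₀ K) :=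
  Finsupp.linearCombination K fun σ : Finset V =>
    if a ∈ σ then 0 else Finsupp.single (insert a σ) 1

theorem cone_single (a : V) (σ : Finset V) (c : K) :
    cone K a (Finsupp.single σ c) = if a ∈ σ then 0 else Finsupp.single (insert a σ) c := by
  simp [cone]

/-- Coning is a contracting homotopy. As `a` is least, it is removed with sign `+1`, and inserting
it flips the sign of every other face, so the mixed terms cancel. If `a ∈ σ`, only the face opposite
`a` contributes. -/
theorem boundary_cone_add_cone_boundary {a : V} (ha : ∀ v, a ≤ v) (x : Finset V →₀ K) :
    boundary K (cone K a x) + cone K a (boundary K x) = x := by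
  suffices h : boundary K ∘ₗ cone K a + cone K a ∘ₗ boundary K = LinearMap.id from
    LinearMap.congr_fun h x
  ext1 σ
  ext1
  simp only [LinearMap.comp_apply, LinearMap.add_apply, Finsupp.lsingle_apply, LinearMap.id_apply]
  rw [boundary_single, map_sum, cone_single]
  simp only [cone_single]
  by_cases h : a ∈ σ
  · rw [if_pos h, map_zero, zero_add, Finset.sum_eq_single a]
    · have : (σ.filter fun w => w < a) = ∅ := Finset.filter_eq_empty_iff.2 fun w _ => (ha w).not_gt
      simp [this, Finset.insert_erase h]
    · intro v _ hva
      rw [if_pos (Finset.mem_erase.2 ⟨hva.symm, h⟩)]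
    · exact fun h' => absurd h h'
  · rw [if_neg h, boundary_single, Finset.sum_insert h, Finset.erase_insert h, add_assoc,
      ← Finset.sum_add_distrib]
    have h0 : ((insert a σ).filter fun w => w < a) = ∅ :=
      Finset.filter_eq_empty_iff.2 fun w _ => (ha w).not_gt
    rw [h0, Finset.card_empty, pow_zero, add_eq_left]
    refine Finset.sum_eq_zero fun v hv => ?_
    have hav : a ≠ v := fun h' => h (h' ▸ hv)
    rw [if_neg fun h' => h (Finset.mem_of_mem_erase h'), Finset.erase_insert_of_ne hav,
      Finset.filter_insert, if_pos (lt_of_le_of_ne (ha v) hav),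
      Finset.card_insert_of_notMem fun h' => h (Finset.mem_of_mem_filter _ h'),
      ← Finsupp.single_add, pow_succ]
    simp

/-- The clique complex of a complete graph is acyclic. -/
theorem finrank_homology_top [OrderBot V] (k : ℕ) :
    Module.finrank K (Homology K (cliqueComplex (⊤ : SimpleGraph V)) k) = 0 := by
  have hsub : Subsingleton (Homology K (cliqueComplex (⊤ : SimpleGraph V)) k) := by
    refine Submodule.Quotient.subsingleton_iff.2 ?_
    rw [eq_top_iff]
    rintro ⟨z, hz⟩ -
    change z ∈ boundaries K _ k
    -- Since `∂z = 0`, the homotopy formula reads `z = ∂(cone z)`.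
    have h := boundary_cone_add_cone_boundary (K := K) (a := (⊥ : V)) (fun _ => bot_le) z
    rw [LinearMap.mem_ker.1 hz.2, map_zero, add_zero] at h
    rw [← h]
    refine Submodule.mem_map_of_mem ?_
    have hz1 := hz.1
    rw [chains_cliqueComplex] at hz1 ⊢
    suffices h : Finsupp.supported K K (cliques (⊤ : SimpleGraph V) (k + 1)) ≤
        (Finsupp.supported K K (cliques (⊤ : SimpleGraph V) (k + 1 + 1))).comap (cone K ⊥) from
      h hz1
    rw [supported_le_iff]
    rintro σ ⟨-, hc⟩
    rw [Submodule.mem_comap, cone_single]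
    split_ifs with hb
    · exact Submodule.zero_mem _
    · exact Finsupp.single_mem_supported _ _ ⟨fun _ _ _ _ h => h, by
        rw [Finset.card_insert_of_notMem hb, hc]⟩
  exact Module.finrank_zero_of_subsingleton

end Betti

/-! ### The graph process -/

section GraphProcess

variable {n : ℕ}

theorem graphAt_adj_iff {τ : Edge n → ℝ} {t : ℝ≥0} {u v : Fin n} :
    (graphAt τ t).Adj u v ↔ ∃ e : Edge n, e.1 = s(u, v) ∧ τ e ≤ t := by
  simp only [graphAt, SimpleGraph.fromEdgeSet_adj, Set.mem_ofPred_eq]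
  constructor
  · rintro ⟨⟨h, h'⟩, -⟩
    exact ⟨⟨_, h⟩, rfl, h'⟩
  · rintro ⟨⟨e, he⟩, rfl, h⟩
    exact ⟨⟨he, h⟩, by simpa using he⟩

theorem graphAt_congr {τ τ' : Edge n → ℝ} {t t' : ℝ≥0} (h : ∀ e, τ e ≤ t ↔ τ' e ≤ t') :
    graphAt τ t = graphAt τ' t' := by
  ext u v
  simp only [graphAt_adj_iff, h]

theorem graphAt_eq_top {τ : Edge n → ℝ} {t : ℝ≥0} (h : ∀ e, τ e ≤ t) : graphAt τ t = ⊤ := by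
  ext u v
  rw [graphAt_adj_iff, SimpleGraph.top_adj]
  constructor
  · rintro ⟨⟨e, he⟩, rfl, -⟩
    simpa using he
  · intro huv
    exact ⟨⟨s(u, v), by simpa using huv⟩, rfl, h _⟩

/-- There are finitely many edges, and each condition `τ e ≤ r` keeps its truth value just after
`t`. -/
theorem rightContinuous_cliqueFiltration (τ : Edge n → ℝ) :
    RightContinuous (cliqueFiltration τ) := by
  intro t
  have h : ∀ᶠ r : ℝ≥0 in nhdsWithin t (Set.Ioi t), ∀ e, τ e ≤ r ↔ τ e ≤ t := by
    refine Filter.eventually_all.2 fun e => ?_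
    rcases le_or_gt (τ e) t with h | h
    · filter_upwards [self_mem_nhdsWithin] with r hr
      exact iff_of_true (h.trans (NNReal.coe_le_coe.2 (le_of_lt hr))) h
    · have : Filter.Tendsto ((↑) : ℝ≥0 → ℝ) (nhdsWithin t (Set.Ioi t)) (nhds t) :=
        (NNReal.continuous_coe.tendsto t).mono_left nhdsWithin_le_nhds
      filter_upwards [this.eventually_lt_const h] with r hr
      exact iff_of_false (not_le.2 hr) (not_le.2 h)
  obtain ⟨s, hts, hs⟩ := mem_nhdsGT_iff_exists_Ioo_subset.1 h
  exact ⟨s, hts, fun r hr hrs => congrArg cliqueComplex (graphAt_congr (hs ⟨hr, hrs⟩))⟩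

/-- The edges inside a set of vertices. -/
def innerEdges (σ : Finset (Fin n)) : Finset (Edge n) :=
  Finset.univ.filter fun e => ∀ v ∈ e.1, v ∈ σ

open Classical in
/-- The edges that join a vertex to a set of vertices. -/
def starEdges (u : Fin n) (σ : Finset (Fin n)) : Finset (Edge n) :=
  Finset.univ.filter fun e => ∃ v ∈ σ, e.1 = s(u, v)

theorem card_innerEdges (σ : Finset (Fin n)) : (innerEdges σ).card = σ.card.choose 2 := by
  rw [← Sym2.card_image_offDiag]
  refine Finset.card_bij (fun e _ => e.1) ?_ (fun _ _ _ _ h => Subtype.ext h) ?_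
  · rintro ⟨e, he⟩ h
    induction e with
    | h u v =>
    simp only [innerEdges, Finset.mem_filter, Finset.mem_univ, true_and] at h
    refine Finset.mem_image.2 ⟨(u, v), Finset.mem_offDiag.2 ⟨h u (by simp), h v (by simp), ?_⟩, rfl⟩
    simpa using he
  · intro e he
    obtain ⟨⟨u, v⟩, huv, rfl⟩ := Finset.mem_image.1 he
    obtain ⟨hu, hv, hne⟩ := Finset.mem_offDiag.1 huv
    refine ⟨⟨s(u, v), by simpa using hne⟩, ?_, rfl⟩
    simp only [innerEdges, Finset.mem_filter, Finset.mem_univ, true_and]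
    intro w hw
    rcases Sym2.mem_iff.1 hw with rfl | rfl
    · exact hu
    · exact hv

theorem card_starEdges {u : Fin n} {σ : Finset (Fin n)} (hu : u ∉ σ) :
    (starEdges u σ).card = σ.card := by
  symm
  have hne : ∀ v ∈ σ, u ≠ v := fun v hv h => hu (h ▸ hv)
  refine Finset.card_bij (fun v hv => ⟨s(u, v), by simpa using hne v hv⟩) ?_ ?_ ?_
  · intro v hv
    simp only [starEdges, Finset.mem_filter, Finset.mem_univ, true_and]
    exact ⟨v, hv, rfl⟩
  · intro v _ w _ h
    exact Sym2.congr_right.1 (Subtype.ext_iff.1 h)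
  · intro e he
    simp only [starEdges, Finset.mem_filter, Finset.mem_univ, true_and] at he
    obtain ⟨v, hv, h⟩ := he
    exact ⟨v, hv, Subtype.ext h.symm⟩

/-- With the next lemma, this separates the edges deciding whether `σ` is critical into disjoint,
hence independent, blocks. -/
theorem disjoint_innerEdges_starEdges {u : Fin n} {σ : Finset (Fin n)} (hu : u ∉ σ) :
    Disjoint (innerEdges σ) (starEdges u σ) := by
  refine Finset.disjoint_left.2 fun e he he' => hu ?_
  simp only [innerEdges, starEdges, Finset.mem_filter, Finset.mem_univ, true_and] at he he'
  obtain ⟨v, -, h⟩ := he'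
  exact he u (by simp [h])

theorem disjoint_starEdges_starEdges {u w : Fin n} {σ : Finset (Fin n)} (hu : u ∉ σ)
    (huw : u ≠ w) : Disjoint (starEdges u σ) (starEdges w σ) := by
  refine Finset.disjoint_left.2 fun e he he' => ?_
  simp only [starEdges, Finset.mem_filter, Finset.mem_univ, true_and] at he he'
  obtain ⟨v, -, h⟩ := he
  obtain ⟨v', hv', h'⟩ := he'
  have : u ∈ s(w, v') := by rw [← h', h]; simp
  rcases Sym2.mem_iff.1 this with h | h
  · exact huw h
  · exact hu (h ▸ hv')

theorem isClique_graphAt_iff {τ : Edge n → ℝ} {t : ℝ≥0} {σ : Finset (Fin n)} :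
    (graphAt τ t).IsClique (σ : Set (Fin n)) ↔ ∀ e ∈ innerEdges σ, τ e ≤ t := by
  simp only [innerEdges, Finset.mem_filter, Finset.mem_univ, true_and]
  constructor
  · rintro h ⟨e, he⟩ hσ
    induction e with
    | h u v =>
    obtain ⟨e', he', ht⟩ :=
      graphAt_adj_iff.1 (h (hσ u (by simp)) (hσ v (by simp)) (by simpa using he))
    rwa [show e' = ⟨s(u, v), he⟩ from Subtype.ext he'] at ht
  · intro h u hu v hv huv
    refine graphAt_adj_iff.2 ⟨⟨s(u, v), by simpa using huv⟩, rfl, h _ fun w hw => ?_⟩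
    rcases Sym2.mem_iff.1 hw with rfl | rfl
    · exact hu
    · exact hv

theorem forall_adj_graphAt_iff {τ : Edge n → ℝ} {t : ℝ≥0} {u : Fin n} {σ : Finset (Fin n)}
    (hu : u ∉ σ) : (∀ v ∈ σ, (graphAt τ t).Adj u v) ↔ ∀ e ∈ starEdges u σ, τ e ≤ t := by
  simp only [starEdges, Finset.mem_filter, Finset.mem_univ, true_and]
  constructor
  · rintro h e ⟨v, hv, he⟩
    obtain ⟨e', he', ht⟩ := graphAt_adj_iff.1 (h v hv)
    rwa [show e' = e from Subtype.ext (he'.trans he.symm)] at ht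
  · intro h v hv
    have hne : u ≠ v := fun h => hu (h ▸ hv)
    exact graphAt_adj_iff.2 ⟨⟨s(u, v), by simpa using hne⟩, rfl, h _ ⟨v, hv, rfl⟩⟩

theorem setOf_mem_cliques {Ω : Type*} {τ : Edge n → Ω → ℝ} {k : ℕ} {t : ℝ}
    (ht : 0 ≤ t) {σ : Finset (Fin n)} (hσ : σ.card = k) :
    {ω | σ ∈ cliques (graphAt (fun e => τ e ω) t.toNNReal) k} =
      ⋂ e ∈ innerEdges σ, {ω | τ e ω ≤ t} := by
  ext ω
  simp [cliques, hσ, isClique_graphAt_iff, ht]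

theorem setOf_mem_criticalCliques {Ω : Type*} {τ : Edge n → Ω → ℝ} {k : ℕ} {t : ℝ}
    (ht : 0 ≤ t) {σ : Finset (Fin n)} (hσ : σ.card = k) :
    {ω | σ ∈ criticalCliques (graphAt (fun e => τ e ω) t.toNNReal) k} =
      (⋂ e ∈ innerEdges σ, {ω | τ e ω ≤ t}) \
        ⋃ u ∈ Finset.univ.filter fun u => ∀ v ∈ σ, u < v,
          ⋂ e ∈ starEdges u σ, {ω | τ e ω ≤ t} := by
  ext ω
  have key (u : Fin n) (hu : ∀ v ∈ σ, u < v) :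
      (∃ v ∈ σ, ¬ (graphAt (fun e => τ e ω) t.toNNReal).Adj u v) ↔
        ¬ ∀ e ∈ starEdges u σ, τ e ω ≤ t := by
    have := forall_adj_graphAt_iff (τ := fun e => τ e ω) (t := t.toNNReal) (σ := σ) (u := u)
      fun h => (hu u h).false
    rw [Real.coe_toNNReal _ ht] at this
    rw [← this]
    push Not
    rfl
  simp only [criticalCliques, Set.mem_ofPred_eq, hσ, isClique_graphAt_iff, true_and,
    Real.coe_toNNReal _ ht, Set.mem_sdiff, Set.mem_iInter, Set.mem_iUnion, Finset.mem_filter,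
    Finset.mem_univ, not_exists]
  refine and_congr Iff.rfl (forall_congr' fun u => ?_)
  constructor
  · intro h1 hu
    exact (key u hu).1 (h1 hu)
  · intro h1 hu
    exact (key u hu).2 (h1 hu)

/-- There are at most `n ^ k` sets of `k + 1` elements of `Fin n` with a given least
element. -/
theorem card_filter_min_le (k : ℕ) (m : Fin n) :
    (Finset.univ.filter fun σ : Finset (Fin n) =>
      σ.card = k + 1 ∧ m ∈ σ ∧ ∀ v ∈ σ, m ≤ v).card ≤ n ^ k := by
  refine le_trans (Finset.card_le_card_of_injOn (t := Finset.powersetCard k Finset.univ)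
    (fun σ => σ.erase m) ?_ ?_) ?_
  · intro σ hσ
    have hσ' := (Finset.mem_filter.1 hσ).2
    exact Finset.mem_powersetCard.2 ⟨Finset.subset_univ _, by
      rw [Finset.card_erase_of_mem hσ'.2.1, hσ'.1, Nat.add_sub_cancel]⟩
  · intro σ hσ ρ hρ hσρ
    have hσ' := (Finset.mem_filter.1 hσ).2
    have hρ' := (Finset.mem_filter.1 hρ).2
    rw [← Finset.insert_erase hσ'.2.1, ← Finset.insert_erase hρ'.2.1]
    exact congrArg _ hσρ
  · rw [Finset.card_powersetCard, Finset.card_univ, Fintype.card_fin]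
    exact Nat.choose_le_pow n k

/-- Group the sets by least element `m`: exactly `m` elements of `Fin n` lie below it, and
`card_filter_min_le` bounds each group. -/
theorem sum_pow_card_le (k : ℕ) {r : ℝ} (hr : 0 ≤ r) :
    ∑ σ : Finset (Fin n) with σ.card = k + 1,
      r ^ (Finset.univ.filter fun u => ∀ v ∈ σ, u < v).card ≤
        n ^ k * ∑ m ∈ Finset.range n, r ^ m := by
  have h1 : ∀ σ ∈ Finset.univ.filter (fun σ : Finset (Fin n) => σ.card = k + 1),
      r ^ (Finset.univ.filter fun u => ∀ v ∈ σ, u < v).card ≤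
        ∑ m : Fin n, if m ∈ σ ∧ ∀ v ∈ σ, m ≤ v then r ^ (m : ℕ) else 0 := by
    intro σ hσ
    have hne : σ.Nonempty := Finset.card_pos.1 (by have := (Finset.mem_filter.1 hσ).2; omega)
    have h2 : (Finset.univ.filter fun u => ∀ v ∈ σ, u < v) = Finset.Iio (σ.min' hne) := by
      ext u
      simp [Finset.lt_min'_iff]
    rw [h2, Fin.card_Iio]
    refine le_trans (le_of_eq ?_) (Finset.single_le_sum (f := fun m : Fin n =>
      if m ∈ σ ∧ ∀ v ∈ σ, m ≤ v then r ^ (m : ℕ) else 0) (fun m _ => ?_)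
        (Finset.mem_univ (σ.min' hne)))
    · rw [if_pos ⟨σ.min'_mem hne, fun v hv => σ.min'_le v hv⟩]
    · positivity
  refine (Finset.sum_le_sum h1).trans ?_
  rw [Finset.sum_comm, ← Fin.sum_univ_eq_sum_range, Finset.mul_sum]
  refine Finset.sum_le_sum fun m _ => ?_
  rw [← Finset.sum_filter, Finset.filter_filter, Finset.sum_const, nsmul_eq_mul]
  refine mul_le_mul_of_nonneg_right ?_ (by positivity)
  exact_mod_cast card_filter_min_le k m

end GraphProcess

/-! ### Probabilities of cliques and critical cliques -/

section Probability

variable {Ω : Type*} [MeasurableSpace Ω] {P : Measure Ω}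

/-- If intersections of the events `A e` have the probabilities of independent events of
probability `p`, then so do the events that all of `A e`, `e ∈ F₀`, and for no `j ∈ J` all of
`A e`, `e ∈ F j`, occur, for disjoint blocks `F₀`, `F j`. -/
theorem measureReal_iInter_diff_iUnion [IsFiniteMeasure P] {ι κ : Type*} [DecidableEq ι]
    {A : ι → Set Ω} (hA : ∀ e, MeasurableSet (A e)) {p : ℝ}
    (hp : ∀ F : Finset ι, P.real (⋂ e ∈ F, A e) = p ^ F.card) (F : κ → Finset ι) (J : Finset κ)
    (hJ : (J : Set κ).PairwiseDisjoint F) (F₀ : Finset ι) (hF₀ : ∀ j ∈ J, Disjoint F₀ (F j)) :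
    P.real ((⋂ e ∈ F₀, A e) \ ⋃ j ∈ J, ⋂ e ∈ F j, A e) =
      p ^ F₀.card * ∏ j ∈ J, (1 - p ^ (F j).card) := by
  classical
  induction J using Finset.induction_on generalizing F₀ with
  | empty => simp [hp]
  | insert a J ha ih =>
    rw [Finset.coe_insert, Set.pairwiseDisjoint_insert_of_notMem (by simpa using ha)] at hJ
    have hm : MeasurableSet (⋂ e ∈ F a, A e) := Finset.measurableSet_biInter _ fun e _ => hA e
    -- For the event `E` belonging to `J`, the probability of `E` without block `a` is that of `E`
    -- minus that of `E` with block `a`. The latter is the case of `F₀` enlarged by `F a`, hence the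
    -- generalization over `F₀`.
    have h1 := ih hJ.1 F₀ fun j hj => hF₀ j (Finset.mem_insert_of_mem hj)
    have h2 := ih hJ.1 (F₀ ∪ F a) fun j hj => Finset.disjoint_union_left.2
      ⟨hF₀ j (Finset.mem_insert_of_mem hj), hJ.2 j hj⟩
    have h3 := measureReal_sdiff_add_inter (μ := P)
      (s := (⋂ e ∈ F₀, A e) \ ⋃ j ∈ J, ⋂ e ∈ F j, A e) hm
    have h4 : ((⋂ e ∈ F₀, A e) \ ⋃ j ∈ J, ⋂ e ∈ F j, A e) ∩ (⋂ e ∈ F a, A e) =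
        (⋂ e ∈ F₀ ∪ F a, A e) \ ⋃ j ∈ J, ⋂ e ∈ F j, A e := by
      have : (⋂ e ∈ F₀ ∪ F a, A e) = (⋂ e ∈ F₀, A e) ∩ ⋂ e ∈ F a, A e := by
        ext ω
        simp only [Set.mem_inter_iff, Set.mem_iInter, Finset.mem_union, or_imp, forall_and]
      rw [this]
      ext ω
      simp only [Set.mem_inter_iff, Set.mem_sdiff]
      tauto
    have h5 : ((⋂ e ∈ F₀, A e) \ ⋃ j ∈ J, ⋂ e ∈ F j, A e) \ (⋂ e ∈ F a, A e) =
        (⋂ e ∈ F₀, A e) \ ⋃ j ∈ insert a J, ⋂ e ∈ F j, A e := by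
      rw [Finset.set_biUnion_insert, Set.sdiff_sdiff, Set.union_comm]
    rw [h4, h5, h1, h2, Finset.card_union_of_disjoint (hF₀ a (Finset.mem_insert_self _ _)),
      pow_add] at h3
    rw [Finset.prod_insert ha]
    linarith

theorem lintegral_ncard [IsFiniteMeasure P] {α : Type*} (S : Ω → Set α) (T : Finset α)
    (hT : ∀ ω, S ω ⊆ T) (hS : ∀ a ∈ T, MeasurableSet {ω | a ∈ S ω}) :
    ∫⁻ ω, ((S ω).ncard : ℝ≥0∞) ∂P = ENNReal.ofReal (∑ a ∈ T, P.real {ω | a ∈ S ω}) := by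
  classical
  have h (ω : Ω) : ((S ω).ncard : ℝ≥0∞) = ∑ a ∈ T, {ω | a ∈ S ω}.indicator (fun _ => 1) ω := by
    have : S ω = (T.filter fun a => a ∈ S ω : Finset α) := by
      ext a
      simpa using fun ha => hT ω ha
    rw [this, Set.ncard_coe_finset, Finset.card_eq_sum_ones, Finset.sum_filter]
    push_cast
    exact Finset.sum_congr rfl fun a _ => by simp [Set.indicator]
  simp_rw [h]
  rw [lintegral_finsetSum' _ fun a ha => (measurable_const.indicator (hS a ha)).aemeasurable,
    ENNReal.ofReal_sum_of_nonneg fun _ _ => measureReal_nonneg]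
  refine Finset.sum_congr rfl fun a ha => ?_
  rw [lintegral_indicator_const (hS a ha), one_mul, ofReal_measureReal]

variable {n : ℕ} {τ : Edge n → Ω → ℝ}

namespace IsErdosRenyiProcess

theorem measureReal_iInter [IsProbabilityMeasure P] (h : IsErdosRenyiProcess P τ) {t : ℝ}
    (ht : t ∈ Set.Icc (0 : ℝ) 1) (F : Finset (Edge n)) :
    P.real (⋂ e ∈ F, {ω | τ e ω ≤ t}) = t ^ F.card := by
  have h1 (e : Edge n) : P {ω | τ e ω ≤ t} = ENNReal.ofReal t := by
    have := (h.uniform e).measure_preimage (by simp) (by simp) (measurableSet_Iic (a := t))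
    have h2 : Set.Icc (0 : ℝ) 1 ∩ Set.Iic t = Set.Icc 0 t := by
      ext x
      simp only [Set.mem_inter_iff, Set.mem_Icc, Set.mem_Iic]
      constructor
      · tauto
      · exact fun hx => ⟨⟨hx.1, hx.2.trans ht.2⟩, hx.2⟩
    rw [h2] at this
    rw [Set.preimage] at this
    simpa using this
  have h2 := h.indep.measure_inter_preimage_eq_mul F (sets := fun _ => Set.Iic t)
    fun e _ => measurableSet_Iic
  change P (⋂ e ∈ F, {ω | τ e ω ≤ t}) = ∏ e ∈ F, P {ω | τ e ω ≤ t} at h2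
  rw [Measure.real, h2]
  simp [h1, ht.1]

theorem measurableSet_le (h : IsErdosRenyiProcess P τ) (t : ℝ) (e : Edge n) :
    MeasurableSet {ω | τ e ω ≤ t} :=
  _root_.measurableSet_le (h.measurable e) measurable_const

theorem lintegral_ncard_cliques [IsProbabilityMeasure P] (h : IsErdosRenyiProcess P τ) (k : ℕ)
    {t : ℝ} (ht : t ∈ Set.Icc (0 : ℝ) 1) :
    ∫⁻ ω, ((cliques (graphAt (fun e => τ e ω) t.toNNReal) k).ncard : ℝ≥0∞) ∂P =
      ENNReal.ofReal (n.choose k * t ^ (k.choose 2)) := by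
  rw [lintegral_ncard _ (Finset.univ.filter fun σ => σ.card = k)
    fun ω σ hσ => by simpa using hσ.2]
  · congr 1
    rw [Finset.sum_congr rfl fun σ hσ => by
        rw [setOf_mem_cliques ht.1 (Finset.mem_filter.1 hσ).2, h.measureReal_iInter ht,
          card_innerEdges, (Finset.mem_filter.1 hσ).2],
      Finset.sum_const, nsmul_eq_mul, Finset.univ_filter_card_eq,
      Finset.card_powersetCard, Finset.card_univ, Fintype.card_fin]
  · intro σ hσ
    rw [setOf_mem_cliques ht.1 (Finset.mem_filter.1 hσ).2]
    exact Finset.measurableSet_biInter _ fun e _ => h.measurableSet_le t e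

theorem lintegral_ncard_criticalCliques_le [IsProbabilityMeasure P]
    (h : IsErdosRenyiProcess P τ) (k : ℕ) {t : ℝ} (ht : t ∈ Set.Icc (0 : ℝ) 1) :
    ∫⁻ ω, ((criticalCliques (graphAt (fun e => τ e ω) t.toNNReal) (k + 1)).ncard : ℝ≥0∞) ∂P ≤
      ENNReal.ofReal (n ^ k * t ^ ((k + 1).choose 2) *
        ∑ m ∈ Finset.range n, (1 - t ^ (k + 1)) ^ m) := by
  classical
  have hprob {σ : Finset (Fin n)} (hσ : σ.card = k + 1) :
      P.real {ω | σ ∈ criticalCliques (graphAt (fun e => τ e ω) t.toNNReal) (k + 1)} =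
        t ^ ((k + 1).choose 2) *
          (1 - t ^ (k + 1)) ^ (Finset.univ.filter fun u => ∀ v ∈ σ, u < v).card := by
    have hnot {u} (hu : u ∈ Finset.univ.filter fun u => ∀ v ∈ σ, u < v) : u ∉ σ :=
      fun h => ((Finset.mem_filter.1 hu).2 u h).false
    rw [setOf_mem_criticalCliques ht.1 hσ,
      measureReal_iInter_diff_iUnion (fun e => h.measurableSet_le t e) (h.measureReal_iInter ht)
        (fun u => starEdges u σ) _
        (fun u hu w _ huw => disjoint_starEdges_starEdges (hnot hu) huw)
        _ (fun u hu => disjoint_innerEdges_starEdges (hnot hu)),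
      card_innerEdges, hσ, Finset.prod_congr rfl fun u hu => by rw [card_starEdges (hnot hu), hσ],
      Finset.prod_const]
  rw [lintegral_ncard _ (Finset.univ.filter fun σ => σ.card = k + 1)
    fun ω σ hσ => by simpa using hσ.1]
  · refine ENNReal.ofReal_le_ofReal ?_
    rw [Finset.sum_congr rfl fun σ hσ => hprob (Finset.mem_filter.1 hσ).2,
      ← Finset.mul_sum, mul_comm ((n : ℝ) ^ k), mul_assoc]
    exact mul_le_mul_of_nonneg_left
      (sum_pow_card_le k (sub_nonneg.2 (pow_le_one₀ ht.1 ht.2))) (pow_nonneg ht.1 _)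
  · intro σ hσ
    rw [setOf_mem_criticalCliques ht.1 (Finset.mem_filter.1 hσ).2]
    exact (Finset.measurableSet_biInter _ fun e _ => h.measurableSet_le t e).diff
      (Finset.measurableSet_biUnion _ fun u _ =>
        Finset.measurableSet_biInter _ fun e _ => h.measurableSet_le t e)

end IsErdosRenyiProcess

end Probability

/-! ### The expected Betti numbers of the graph process -/

section ExpectedBetti

variable (K : Type*) [Field K] {Ω : Type*} [MeasurableSpace Ω] (P : Measure Ω) {n : ℕ}
  (τ : Edge n → Ω → ℝ)

/-- The expected Betti number of the clique complex at time `t`. -/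
noncomputable def expectedBetti (k : ℕ) (t : ℝ) : ℝ≥0∞ :=
  ∫⁻ ω, (Module.finrank K
    (Homology K (cliqueComplex (graphAt (fun e => τ e ω) t.toNNReal)) k) : ℝ≥0∞) ∂P

variable {P τ}

namespace IsErdosRenyiProcess

/-- The graph depends on `(ω, t)` only through the set of edges present, which takes finitely many
values. Joint measurability is what Tonelli's theorem requires. -/
theorem measurable_comp_graphAt (h : IsErdosRenyiProcess P τ)
    (F : SimpleGraph (Fin n) → ℝ≥0∞) :
    Measurable fun x : Ω × ℝ => F (graphAt (fun e => τ e x.1) x.2.toNNReal) := by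
  let E (x : Ω × ℝ) : Set (Edge n) := {e | τ e x.1 ≤ x.2.toNNReal}
  have hE : Measurable E := by
    refine measurable_set_iff.2 fun e => measurableSet_setOfPred.1 ?_
    exact _root_.measurableSet_le ((h.measurable e).comp measurable_fst)
      (measurable_real_toNNReal.coe_nnreal_real.comp measurable_snd)
  have hF : Measurable fun S : Set (Edge n) =>
      F (SimpleGraph.fromEdgeSet {e | ∃ h : e ∈ (⊤ : SimpleGraph (Fin n)).edgeSet, ⟨e, h⟩ ∈ S}) :=
    measurable_of_countable _
  exact hF.comp hE

theorem measurable_comp_graphAt_left (h : IsErdosRenyiProcess P τ)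
    (F : SimpleGraph (Fin n) → ℝ≥0∞) (t : ℝ) :
    Measurable fun ω => F (graphAt (fun e => τ e ω) t.toNNReal) :=
  (h.measurable_comp_graphAt F).comp measurable_prodMk_right

theorem measurable_cliqueLifetimeSum (h : IsErdosRenyiProcess P τ) (k : ℕ) :
    Measurable (cliqueLifetimeSum K τ k) := by
  have := (h.measurable_comp_graphAt fun G =>
    (Module.finrank K (Homology K (cliqueComplex G) k) : ℝ≥0∞)).lintegral_prod_right'
      (ν := volume.restrict (Set.Ici 0))
  convert this with ω
  exact lifetimeSum_eq_lintegral _ (rightContinuous_cliqueFiltration _) k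

/-- The expected lifetime sum is the integral of the expected Betti number over time. -/
theorem lintegral_cliqueLifetimeSum_eq_Ici [IsProbabilityMeasure P] (h : IsErdosRenyiProcess P τ)
    (k : ℕ) :
    ∫⁻ ω, cliqueLifetimeSum K τ k ω ∂P = ∫⁻ t in Set.Ici 0, expectedBetti K P τ k t := by
  unfold expectedBetti
  rw [lintegral_lintegral_swap]
  · exact lintegral_congr fun ω =>
      lifetimeSum_eq_lintegral _ (rightContinuous_cliqueFiltration _) k
  · exact ((h.measurable_comp_graphAt fun G =>
      (Module.finrank K (Homology K (cliqueComplex G) k) : ℝ≥0∞)).comp measurable_swap).aemeasurable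

theorem ae_le_one (h : IsErdosRenyiProcess P τ) : ∀ᵐ ω ∂P, ∀ e, τ e ω ≤ 1 := by
  refine ae_all_iff.2 fun e => ?_
  have := (h.uniform e).measure_preimage (by simp) (by simp) (measurableSet_Ioi (a := (1 : ℝ)))
  have h2 : Set.Icc (0 : ℝ) 1 ∩ Set.Ioi 1 = ∅ := by
    ext x
    simp only [Set.mem_inter_iff, Set.mem_Icc, Set.mem_Ioi, Set.mem_empty_iff_false, iff_false]
    exact fun hx => absurd hx.1.2 (not_le.2 hx.2)
  rw [h2, measure_empty, ENNReal.zero_div] at this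
  rw [ae_iff]
  simpa [Set.preimage] using this

theorem expectedBetti_eq_zero [NeZero n] (h : IsErdosRenyiProcess P τ) (k : ℕ) {t : ℝ}
    (ht : 1 ≤ t) : expectedBetti K P τ k t = 0 := by
  rw [expectedBetti, ← lintegral_zero (μ := P)]
  refine lintegral_congr_ae ?_
  filter_upwards [h.ae_le_one] with ω hω
  rw [graphAt_eq_top fun e => (hω e).trans (ht.trans (Real.le_coe_toNNReal t)),
    finrank_homology_top, Nat.cast_zero]

theorem lintegral_cliqueLifetimeSum [IsProbabilityMeasure P] [NeZero n]
    (h : IsErdosRenyiProcess P τ) (k : ℕ) :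
    ∫⁻ ω, cliqueLifetimeSum K τ k ω ∂P = ∫⁻ t in Set.Ioc 0 1, expectedBetti K P τ k t := by
  rw [h.lintegral_cliqueLifetimeSum_eq_Ici K, ← setLIntegral_congr Ioi_ae_eq_Ici,
    ← Set.Ioc_union_Ioi_eq_Ioi (zero_le_one' ℝ),
    lintegral_union measurableSet_Ioi Set.Ioc_disjoint_Ioi_same,
    setLIntegral_congr_fun (g := fun _ => 0) measurableSet_Ioi
      fun t (ht : 1 < t) => h.expectedBetti_eq_zero K k ht.le, lintegral_zero, add_zero]

/-! ### Bounds for the expected Betti number at a fixed time -/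

theorem expectedBetti_le [IsProbabilityMeasure P] (h : IsErdosRenyiProcess P τ) (k : ℕ) {t : ℝ}
    (ht : t ∈ Set.Icc (0 : ℝ) 1) :
    expectedBetti K P τ k t ≤ ENNReal.ofReal (n ^ k * t ^ ((k + 1).choose 2) *
        ∑ m ∈ Finset.range n, (1 - t ^ (k + 1)) ^ m) :=
  (lintegral_mono fun _ => Nat.cast_le.2 (finrank_homology_le _ k)).trans
    (h.lintegral_ncard_criticalCliques_le k ht)

/-- Every term of the geometric sum is at most `1`. This serves for `t ≤ 1/n` when `k ≤ 1`, where
the bound by the full series is not integrable at `0`. -/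
theorem expectedBetti_le_pow [IsProbabilityMeasure P] (h : IsErdosRenyiProcess P τ) (k : ℕ)
    {t : ℝ} (ht : t ∈ Set.Icc (0 : ℝ) 1) :
    expectedBetti K P τ k t ≤ ENNReal.ofReal (n ^ (k + 1)) := by
  refine (h.expectedBetti_le K k ht).trans (ENNReal.ofReal_le_ofReal ?_)
  have h0 : 0 ≤ 1 - t ^ (k + 1) := sub_nonneg.2 (pow_le_one₀ ht.1 ht.2)
  have h1 : ∑ m ∈ Finset.range n, (1 - t ^ (k + 1)) ^ m ≤ n := by
    refine (Finset.sum_le_card_nsmul _ _ 1 fun m _ => pow_le_one₀ h0 ?_).trans (by simp)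
    linarith [pow_nonneg ht.1 (k + 1)]
  rw [pow_succ (n : ℝ) k]
  refine mul_le_mul ?_ h1 (Finset.sum_nonneg fun m _ => pow_nonneg h0 m) (by positivity)
  exact mul_le_of_le_one_right (by positivity) (pow_le_one₀ ht.1 ht.2)

theorem expectedBetti_le_mul_div [IsProbabilityMeasure P] (h : IsErdosRenyiProcess P τ) (k : ℕ)
    {t : ℝ} (ht : t ∈ Set.Ioc (0 : ℝ) 1) :
    expectedBetti K P τ k t ≤
      ENNReal.ofReal (n ^ k * (t ^ ((k + 1).choose 2) / t ^ (k + 1))) := by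
  refine (h.expectedBetti_le K k ⟨ht.1.le, ht.2⟩).trans (ENNReal.ofReal_le_ofReal ?_)
  have hq : 0 < t ^ (k + 1) := pow_pos ht.1 _
  have h0 : 0 ≤ 1 - t ^ (k + 1) := sub_nonneg.2 (pow_le_one₀ ht.1.le ht.2)
  have h1 : ∑ m ∈ Finset.range n, (1 - t ^ (k + 1)) ^ m ≤ 1 / t ^ (k + 1) := by
    rw [le_div_iff₀ hq]
    have := geom_sum_mul_neg (1 - t ^ (k + 1)) n
    rw [sub_sub_cancel] at this
    rw [this]
    linarith [pow_nonneg h0 n]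
  calc _ ≤ n ^ k * t ^ ((k + 1).choose 2) * (1 / t ^ (k + 1)) :=
        mul_le_mul_of_nonneg_left h1 (mul_nonneg (by positivity) (pow_nonneg ht.1.le _))
    _ = _ := by ring

/-- The expectation of `ncard_cliques_le`, kept additive because subtraction in `ℝ≥0∞` truncates. -/
theorem ofReal_le_expectedBetti_add [IsProbabilityMeasure P] (h : IsErdosRenyiProcess P τ) (k : ℕ)
    {t : ℝ} (ht : t ∈ Set.Icc (0 : ℝ) 1) :
    ENNReal.ofReal (n.choose (k + 1) * t ^ ((k + 1).choose 2)) ≤ expectedBetti K P τ k t +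
      ENNReal.ofReal (n.choose k * t ^ (k.choose 2)) +
      ENNReal.ofReal (n.choose (k + 2) * t ^ ((k + 2).choose 2)) := by
  rw [← h.lintegral_ncard_cliques _ ht, ← h.lintegral_ncard_cliques _ ht,
    ← h.lintegral_ncard_cliques _ ht, expectedBetti,
    ← lintegral_add_right _
      (h.measurable_comp_graphAt_left (fun G => ((cliques G k).ncard : ℝ≥0∞)) t),
    ← lintegral_add_right _
      (h.measurable_comp_graphAt_left (fun G => ((cliques G (k + 2)).ncard : ℝ≥0∞)) t)]
  refine lintegral_mono fun ω => ?_
  have := (Nat.cast_le (α := ℝ≥0∞)).2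
    (ncard_cliques_le (K := K) (graphAt (fun e => τ e ω) t.toNNReal) k)
  rwa [Nat.cast_add, Nat.cast_add] at this

/-! ### Upper bounds for the expected lifetime sum -/

theorem lintegral_cliqueLifetimeSum_le_of_two_le [IsProbabilityMeasure P] [NeZero n]
    (h : IsErdosRenyiProcess P τ) {k : ℕ} (hk : 2 ≤ k) :
    ∫⁻ ω, cliqueLifetimeSum K τ k ω ∂P ≤ ENNReal.ofReal (n ^ k) := by
  rw [h.lintegral_cliqueLifetimeSum K]
  have h1 : ∀ t ∈ Set.Ioc (0 : ℝ) 1, expectedBetti K P τ k t ≤ ENNReal.ofReal (n ^ k) := by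
    intro t ht
    refine (h.expectedBetti_le_mul_div K k ht).trans (ENNReal.ofReal_le_ofReal ?_)
    refine mul_le_of_le_one_right (by positivity) ?_
    rw [div_le_one (pow_pos ht.1 _)]
    -- The remaining inequality `k + 1 ≤ C(k+1,2)` is where `k ≥ 2` enters.
    refine pow_le_pow_of_le_one ht.1.le ht.2 ?_
    rw [Nat.choose_two_right, Nat.le_div_iff_mul_le two_pos]
    exact Nat.mul_le_mul_left _ (by simpa using hk)
  refine (setLIntegral_mono' measurableSet_Ioc h1).trans ?_
  simp

/-- Split at `1/n`. Below it the trivial bound `n ^ (k+1)` integrates to `n ^ k`. Above it the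
exponent `C(k+1,2) - (k+1)` is `-1` for both `k = 0` and `k = 1`, so the integral of `n ^ k / t` is
`n ^ k * log n`. -/
theorem lintegral_cliqueLifetimeSum_le_of_le_one [IsProbabilityMeasure P] [NeZero n]
    (h : IsErdosRenyiProcess P τ) {k : ℕ} (hk : k ≤ 1) :
    ∫⁻ ω, cliqueLifetimeSum K τ k ω ∂P ≤ ENNReal.ofReal (n ^ k * (1 + Real.log n)) := by
  have hn : (1 : ℝ) ≤ n := by exact_mod_cast NeZero.one_le
  have hn0 : (0 : ℝ) < n := by linarith
  have hinv : (n : ℝ)⁻¹ ≤ 1 := inv_le_one_of_one_le₀ hn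
  have hinv0 : 0 < (n : ℝ)⁻¹ := inv_pos.2 hn0
  rw [h.lintegral_cliqueLifetimeSum K, ← Set.Ioc_union_Ioc_eq_Ioc hinv0.le hinv,
    lintegral_union measurableSet_Ioc (Set.Ioc_disjoint_Ioc_of_le le_rfl), mul_add, mul_one,
    ENNReal.ofReal_add (by positivity) (mul_nonneg (by positivity) (Real.log_nonneg hn))]
  refine add_le_add ?_ ?_
  · refine (setLIntegral_mono' measurableSet_Ioc fun t ht =>
      h.expectedBetti_le_pow K k ⟨ht.1.le, ht.2.trans hinv⟩).trans ?_
    rw [setLIntegral_const, Real.volume_Ioc, ← ENNReal.ofReal_mul (by positivity), sub_zero,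
      pow_succ, mul_assoc, mul_inv_cancel₀ hn0.ne', mul_one]
  · have h1 : ∀ t ∈ Set.Ioc (n : ℝ)⁻¹ 1,
        expectedBetti K P τ k t ≤ ENNReal.ofReal (n ^ k * t⁻¹) := by
      intro t ht
      have ht0 : 0 < t := hinv0.trans ht.1
      refine (h.expectedBetti_le_mul_div K k ⟨ht0, ht.2⟩).trans_eq ?_
      congr 2
      interval_cases k
      · simp
      · norm_num
        field_simp
    refine (setLIntegral_mono' measurableSet_Ioc h1).trans ?_
    have h0 : (0 : ℝ) ∉ Set.uIcc (n : ℝ)⁻¹ 1 := by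
      rw [Set.uIcc_of_le hinv]
      exact fun h => absurd h.1 (not_le.2 hinv0)
    have hint : IntervalIntegrable (fun t : ℝ => (n : ℝ) ^ k * t⁻¹) volume (n : ℝ)⁻¹ 1 :=
      (intervalIntegral.intervalIntegrable_inv (fun x hx hx0 => h0 (hx0 ▸ hx))
        continuousOn_id).const_mul _
    rw [← ofReal_integral_eq_lintegral_ofReal
        ((intervalIntegrable_iff_integrableOn_Ioc_of_le hinv).1 hint),
      ← intervalIntegral.integral_of_le hinv, intervalIntegral.integral_const_mul,
      integral_inv h0, div_inv_eq_mul, one_mul]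
    filter_upwards [ae_restrict_mem measurableSet_Ioc] with t ht
    exact mul_nonneg (by positivity) (inv_nonneg.2 (hinv0.trans ht.1).le)

/-! ### The lower bound for the expected lifetime sum -/

/-- In the window `s / 2 ≤ t ≤ s`, where `n * s ^ (k + 1) = 1`, the `k`-simplices of the clique
complex outnumber those of the neighbouring dimensions. -/
theorem ofReal_le_expectedBetti [IsProbabilityMeasure P] (h : IsErdosRenyiProcess P τ) (k : ℕ)
    {s t : ℝ} (hs0 : 0 < s) (hs1 : s ≤ 1) (hns : n * s ^ (k + 1) = 1) (hn : 2 * k ≤ n)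
    (hs : s * (2 ^ (k + 1) * (4 * (k + 1))) ≤ 1) (hst : s / 2 ≤ t) (hts : t ≤ s) :
    ENNReal.ofReal (n.choose (k + 1) * t ^ ((k + 1).choose 2) / 4) ≤ expectedBetti K P τ k t := by
  have ht0 : 0 < t := by linarith
  have hmain := h.ofReal_le_expectedBetti_add K k (t := t) ⟨ht0.le, hts.trans hs1⟩
  set x₁ := (n.choose (k + 1) : ℝ) * t ^ ((k + 1).choose 2) with hx₁
  set x₀ := (n.choose k : ℝ) * t ^ (k.choose 2) with hx₀
  set x₂ := (n.choose (k + 2) : ℝ) * t ^ ((k + 2).choose 2) with hx₂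
  have hx₁0 : 0 ≤ x₁ := by positivity
  have hx₀0 : 0 ≤ x₀ := by positivity
  have hx₂0 : 0 ≤ x₂ := by positivity
  -- The ratio `x₂ / x₁` is at most `n * t ^ (k+1) / (k+2)`, and `n * t ^ (k+1) ≤ n * s ^ (k+1) =
  -- 1`.
  have h2 : x₂ ≤ x₁ / 2 := by
    have e1 : (n.choose (k + 2) : ℝ) * (k + 2) ≤ n.choose (k + 1) * n := by
      have := Nat.choose_succ_right_eq n (k + 1)
      have h' : n.choose (k + 1) * (n - (k + 1)) ≤ n.choose (k + 1) * n :=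
        Nat.mul_le_mul_left _ (Nat.sub_le _ _)
      rw [← this] at h'
      exact_mod_cast h'
    have e2 : (k + 2).choose 2 = (k + 1).choose 2 + (k + 1) := by
      rw [Nat.choose_succ_succ' (k + 1) 1, Nat.choose_one_right, add_comm]
    have e3 : n * t ^ (k + 1) ≤ 1 := by
      rw [← hns]
      gcongr
    have e4 : x₂ * (k + 2) ≤ x₁ := by
      calc x₂ * (k + 2) = (n.choose (k + 2) * (k + 2)) * t ^ ((k + 2).choose 2) := by
            rw [hx₂]; ring
        _ ≤ (n.choose (k + 1) * n) * t ^ ((k + 2).choose 2) := by gcongr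
        _ = x₁ * (n * t ^ (k + 1)) := by rw [hx₁, e2, pow_add]; ring
        _ ≤ x₁ := mul_le_of_le_one_right hx₁0 e3
    have e5 : x₂ * 2 ≤ x₂ * (k + 2) := by
      gcongr
      linarith [Nat.cast_nonneg (α := ℝ) k]
    linarith
  -- Here `x₁ / x₀ = (n - k) * t ^ k / (k+1)`, and `(n - k) * t ^ k ≥ (n/2) * (s/2) ^ k = 1 / (s * 2
  -- ^ (k+1))`, which `hs` makes at least `4 * (k+1)`. With the previous step, `x₁ / 4` is left
  -- over.
  have h0 : x₀ ≤ x₁ / 4 := by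
    have e1 : (n.choose (k + 1) : ℝ) * (k + 1) = n.choose k * (n - k) := by
      rw [← Nat.cast_sub (by omega)]
      exact_mod_cast Nat.choose_succ_right_eq n k
    have e2 : (k + 1).choose 2 = k.choose 2 + k := by
      rw [Nat.choose_succ_succ' k 1, Nat.choose_one_right, add_comm]
    have e3 : (4 * (k + 1) : ℝ) ≤ (n - k) * t ^ k := by
      have f1 : (n / 2 : ℝ) ≤ n - k := by
        have : (2 * k : ℝ) ≤ n := by exact_mod_cast hn
        linarith
      have f2 : (s / 2) ^ k ≤ t ^ k := by gcongr
      have f3 : (n / 2 : ℝ) * (s / 2) ^ k * (s * 2 ^ (k + 1)) = 1 := by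
        rw [← hns, div_pow]
        field_simp
        ring
      have f4 : (4 * (k + 1) : ℝ) ≤ (n / 2 : ℝ) * (s / 2) ^ k := by
        refine le_of_mul_le_mul_right ?_ (show 0 < s * 2 ^ (k + 1) by positivity)
        rw [f3]
        linarith
      refine f4.trans (mul_le_mul f1 f2 (by positivity) ?_)
      exact le_trans (by positivity) f1
    have e4 : x₁ * (k + 1) = x₀ * ((n - k) * t ^ k) := by
      rw [hx₁, hx₀, e2, pow_add]
      linear_combination t ^ (k.choose 2) * t ^ k * e1
    have e5 : x₀ * (4 * (k + 1)) ≤ x₁ * (k + 1) := by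
      rw [e4]
      gcongr
    have : 0 < (k + 1 : ℝ) := by positivity
    nlinarith
  rw [add_assoc, ← ENNReal.ofReal_add hx₀0 hx₂0] at hmain
  calc ENNReal.ofReal (x₁ / 4) ≤ ENNReal.ofReal (x₁ - (x₀ + x₂)) :=
        ENNReal.ofReal_le_ofReal (by linarith)
    _ = ENNReal.ofReal x₁ - ENNReal.ofReal (x₀ + x₂) := ENNReal.ofReal_sub _ (by positivity)
    _ ≤ _ := tsub_le_iff_right.2 hmain

/-- In the constant, `2 ^ (k+1) * (k+1)!` comes from `n.choose (k+1) ≥ (n/2) ^ (k+1) / (k+1)!`, the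
`4` from the surviving quarter, `2 ^ C(k+1,2)` from `t ≥ s/2`, and the last `2` from the window
length `s/2`. -/
theorem le_lintegral_cliqueLifetimeSum_of_window [IsProbabilityMeasure P] [NeZero n]
    (h : IsErdosRenyiProcess P τ) (k : ℕ) {s : ℝ} (hs0 : 0 < s) (hs1 : s ≤ 1)
    (hns : n * s ^ (k + 1) = 1) (hn : 2 * k ≤ n) (hs : s * (2 ^ (k + 1) * (4 * (k + 1))) ≤ 1) :
    ENNReal.ofReal ((2 ^ (k + 1) * ((k + 1).factorial : ℝ) * 4 * 2 ^ ((k + 1).choose 2) * 2)⁻¹ *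
      (n ^ (k + 1) * s ^ ((k + 1).choose 2 + 1))) ≤ ∫⁻ ω, cliqueLifetimeSum K τ k ω ∂P := by
  rw [h.lintegral_cliqueLifetimeSum K]
  have hchoose : ((n / 2 : ℝ) ^ (k + 1) / (k + 1).factorial) ≤ n.choose (k + 1) := by
    refine le_trans ?_ (Nat.pow_le_choose (k + 1) n)
    gcongr
    rw [show n + 1 - (k + 1) = n - k by omega, Nat.cast_sub (by omega)]
    have : (2 * k : ℝ) ≤ n := by exact_mod_cast hn
    linarith
  set b : ℝ := (n / 2 : ℝ) ^ (k + 1) / (k + 1).factorial * (s / 2) ^ ((k + 1).choose 2) / 4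
  have h1 : ∀ t ∈ Set.Ioc (s / 2) s, ENNReal.ofReal b ≤ expectedBetti K P τ k t := by
    intro t ht
    refine le_trans (ENNReal.ofReal_le_ofReal ?_)
      (h.ofReal_le_expectedBetti K k hs0 hs1 hns hn hs ht.1.le ht.2)
    have := ht.1.le
    simp only [b]
    gcongr
  calc _ = ENNReal.ofReal b * ENNReal.ofReal (s - s / 2) := by
        rw [← ENNReal.ofReal_mul (by positivity)]
        congr 1
        simp only [b, div_pow, pow_succ]
        field_simp
        ring
    _ = ∫⁻ t in Set.Ioc (s / 2) s, ENNReal.ofReal b := by rw [setLIntegral_const, Real.volume_Ioc]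
    _ ≤ ∫⁻ t in Set.Ioc (s / 2) s, expectedBetti K P τ k t :=
        setLIntegral_mono' measurableSet_Ioc h1
    _ ≤ _ := lintegral_mono_set (Set.Ioc_subset_Ioc (by positivity) hs1)

end IsErdosRenyiProcess

/-- Take `s = n ^ (-1/(k+1))` in the window bound; `s → 0` makes the smallness condition hold
eventually. The constant and the threshold for `n` depend on `k` alone, not on the field or the
probability space. -/
theorem eventually_le_lintegral_cliqueLifetimeSum (k : ℕ) : ∃ c : ℝ, 0 < c ∧
    ∀ᶠ n : ℕ in Filter.atTop, ∀ (K : Type u) [Field K]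
      (Ω : Type v) [MeasurableSpace Ω] (P : Measure Ω) [IsProbabilityMeasure P]
      (τ : Edge n → Ω → ℝ), IsErdosRenyiProcess P τ →
      ENNReal.ofReal (c * (n : ℝ) ^ ((k : ℝ) * (k + 3) / (2 * (k + 1)))) ≤
        ∫⁻ ω, cliqueLifetimeSum K τ k ω ∂P := by
  refine ⟨(2 ^ (k + 1) * (k + 1).factorial * 4 * 2 ^ ((k + 1).choose 2) * 2)⁻¹, by positivity, ?_⟩
  have hlim : Filter.Tendsto (fun n : ℕ => (n : ℝ) ^ (-(1 / (k + 1 : ℝ))) *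
      (2 ^ (k + 1) * (4 * (k + 1)))) Filter.atTop (nhds 0) := by
    have h1 := (tendsto_rpow_neg_atTop (y := 1 / (k + 1 : ℝ)) (by positivity)).comp
      tendsto_natCast_atTop_atTop
    simpa using h1.mul_const (2 ^ (k + 1) * (4 * (k + 1) : ℝ))
  filter_upwards [hlim.eventually_le_const one_pos, Filter.eventually_ge_atTop (2 * k),
    Filter.eventually_ge_atTop 1] with n hs hn hn1 K _ Ω _ P _ τ h
  have : NeZero n := ⟨by omega⟩
  have hn0 : (0 : ℝ) < n := by exact_mod_cast hn1
  have hn1' : (1 : ℝ) ≤ n := by exact_mod_cast hn1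
  have hk : (k + 1 : ℝ) ≠ 0 := by positivity
  refine le_of_eq_of_le ?_ (h.le_lintegral_cliqueLifetimeSum_of_window K k
    (s := (n : ℝ) ^ (-(1 / (k + 1 : ℝ)))) (by positivity)
    (Real.rpow_le_one_of_one_le_of_nonpos hn1' (neg_nonpos.2 (by positivity))) ?_ hn hs)
  · congr 2
    rw [← Real.rpow_natCast, ← Real.rpow_natCast, ← Real.rpow_mul hn0.le, ← Real.rpow_add hn0]
    congr 1
    push_cast
    rw [Nat.cast_choose_two]
    push_cast
    field_simp
    ring
  · rw [← Real.rpow_natCast, ← Real.rpow_mul hn0.le]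
    nth_rewrite 1 [← Real.rpow_one (n : ℝ)]
    rw [← Real.rpow_add hn0]
    push_cast
    rw [neg_mul, one_div_mul_cancel hk, add_neg_cancel, Real.rpow_zero]

end ExpectedBetti

end SimplicialPersistence

/-! ### Assembly of the bounds -/

open SimplicialPersistence in
theorem mainTheorem3 :
    (∀ d : ℕ, d = 1 ∨ d = 2 → ∃ c C : ℝ, 0 < c ∧ 0 < C ∧
      ∀ᶠ n : ℕ in Filter.atTop,
        ∀ (K : Type u) [Field K] [CharZero K]
          (Ω : Type v) [MeasurableSpace Ω] (P : Measure Ω) [IsProbabilityMeasure P]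
          (τ : Edge n → Ω → ℝ), IsErdosRenyiProcess P τ →
          AEMeasurable (cliqueLifetimeSum K τ (d - 1)) P ∧
          ENNReal.ofReal (c * (n : ℝ) ^ (d - 1)) ≤ ∫⁻ ω, cliqueLifetimeSum K τ (d - 1) ω ∂P ∧
          ∫⁻ ω, cliqueLifetimeSum K τ (d - 1) ω ∂P ≤
            ENNReal.ofReal (C * (n : ℝ) ^ (d - 1) * Real.log n)) ∧
    (∀ d : ℕ, 3 ≤ d → ∃ c C : ℝ, 0 < c ∧ 0 < C ∧
      ∀ᶠ n : ℕ in Filter.atTop,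
        ∀ (K : Type u) [Field K] [CharZero K]
          (Ω : Type v) [MeasurableSpace Ω] (P : Measure Ω) [IsProbabilityMeasure P]
          (τ : Edge n → Ω → ℝ), IsErdosRenyiProcess P τ →
          AEMeasurable (cliqueLifetimeSum K τ (d - 1)) P ∧
          ENNReal.ofReal (c * (n : ℝ) ^ ((((d : ℝ) + 2) * ((d : ℝ) - 1)) / (2 * (d : ℝ)))) ≤
            ∫⁻ ω, cliqueLifetimeSum K τ (d - 1) ω ∂P ∧
          ∫⁻ ω, cliqueLifetimeSum K τ (d - 1) ω ∂P ≤
            ENNReal.ofReal (C * (n : ℝ) ^ (d - 1))) := by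
  refine ⟨fun d hd => ?_, fun d hd => ?_⟩
  · obtain ⟨k, rfl⟩ : ∃ k, d = k + 1 := ⟨d - 1, by omega⟩
    have hk : k ≤ 1 := by omega
    rw [Nat.add_sub_cancel]
    obtain ⟨c, hc, hlow⟩ := eventually_le_lintegral_cliqueLifetimeSum.{u, v} k
    -- The `2` absorbs the summand `1`: `1 + log n ≤ 2 * log n` once `log n ≥ 1`.
    refine ⟨c, 2, hc, two_pos, ?_⟩
    filter_upwards [hlow, Filter.eventually_ge_atTop 1,
      (Real.tendsto_log_atTop.comp tendsto_natCast_atTop_atTop).eventually_ge_atTop 1]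
      with n hlow hn hlog K _ _ Ω _ P _ τ h
    have : NeZero n := ⟨by omega⟩
    refine ⟨(h.measurable_cliqueLifetimeSum K k).aemeasurable, ?_,
      (h.lintegral_cliqueLifetimeSum_le_of_le_one K hk).trans (ENNReal.ofReal_le_ofReal ?_)⟩
    · convert hlow K Ω P τ h using 3
      rw [← Real.rpow_natCast]
      congr 1
      -- The exponent `k(k+3) / (2(k+1))` equals `k` exactly for `k = 0` and `k = 1`, so the lower
      -- bound has order `n ^ k` there.
      interval_cases k <;> norm_num
    · have hlog' : 1 ≤ Real.log n := hlog
      have : (n : ℝ) ^ k * (1 + Real.log n) ≤ n ^ k * (2 * Real.log n) := by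
        gcongr
        linarith
      linarith
  · obtain ⟨k, rfl⟩ : ∃ k, d = k + 1 := ⟨d - 1, by omega⟩
    have hk : 2 ≤ k := by omega
    rw [Nat.add_sub_cancel]
    obtain ⟨c, hc, hlow⟩ := eventually_le_lintegral_cliqueLifetimeSum.{u, v} k
    refine ⟨c, 1, hc, one_pos, ?_⟩
    filter_upwards [hlow, Filter.eventually_ge_atTop 1] with n hlow hn K _ _ Ω _ P _ τ h
    have : NeZero n := ⟨by omega⟩
    refine ⟨(h.measurable_cliqueLifetimeSum K k).aemeasurable, ?_, ?_⟩
    · convert hlow K Ω P τ h using 4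
      push_cast
      ring
    · rw [one_mul]
      exact h.lintegral_cliqueLifetimeSum_le_of_two_le K hk
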